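/- Let $I=(0,1)$. For $0<s<1$, $1\le p<\infty$ and $u\in L^p(I)$ let $$|u|_{W^{s,p}(I)}:=\left(\int_I\int_I\frac{|u(x)-u(y)|^p}{|x-y|^{1+sp}}\,dx\,dy\right)^{1/p}$$ be the Gagliardo seminorm, and write $u\in W^{s,p}(I)$ if $\|u\|_{L^p(I)}+|u|_{W^{s,p}(I)}<+\infty$. A function $u\in L^1(I)$ belongs to $BV(I)$ if its distributional derivative $u'$ is a finite signed Borel measure on $I$; $|u'|_{\mathcal M_b(I)}$ denotes the total variation of this measure on $I$. Let $\{s_n\}\subset(0,1)$ be such that $s_n\to\bar s$ with $\bar s\in(0,1]$. For every $n\in\mathbb N$ let $v_n\in W^{s_n,1+s_n(1-s_n)}(I)$ be such that $$\sup_{n}\, s_n(1-s_n)\left\{|v_n|_{W^{s_n,1+s_n(1-s_n)}(I)}+\Big|\int_I v_n(x)\,dx\Big|\right\}<+\infty .$$ (1) If $\bar s\in(0,1)$, then there exist $\bar v\in W^{\bar s,1+\bar s(1-\bar s)}(I)$ and a subsequence $\{n_j\}$ such that $v_{n_j}\to\bar v$ strongly in $L^1(I)$ and $$\liminf_{j\to\infty}s_{n_j}(1-s_{n_j})|v_{n_j}|_{W^{s_{n_j},1+s_{n_j}(1-s_{n_j})}(I)}\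 \ge\ \bar s(1-\bar s)\,|\bar v|_{W^{\bar s,1+\bar s(1-\bar s)}(I)} .$$ (2) If $\bar s=1$, then there exist $\bar v\in BV(I)$ and a subsequence $\{n_j\}$ such that $v_{n_j}-\int_I v_{n_j}(x)\,dx\to\bar v$ strongly in $L^1(I)$ and $$\liminf_{j\to\infty}s_{n_j}(1-s_{n_j})|v_{n_j}|_{W^{s_{n_j},1+s_{n_j}(1-s_{n_j})}(I)}\ \ge\ |\bar v'|_{\mathcal M_b(I)} .$$ -/

import Mathlib

open MeasureTheory Filter Topology Set
open scoped ENNReal Distributions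

noncomputable section

namespace FracSobolev

/-- The open unit interval `I = (0,1)`. -/
abbrev unitI : Set ℝ := Ioo 0 1

/-- The unit interval `I = (0,1)` as an open set; `𝓓(unitIOpens, ℝ)` is the space `C_c^∞(I)`. -/
def unitIOpens : TopologicalSpace.Opens ℝ := ⟨unitI, isOpen_Ioo⟩

/-- The Gagliardo seminorm
`|u|_{W^{s,p}(I)} = (∫_I ∫_I |u(x) - u(y)|^p / |x - y|^{1 + s p} dx dy)^{1/p}`,
with values in `[0,∞]`. Functions on `I` are represented by functions on `ℝ`, of which only the
restriction to `I` is used. -/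
def gagliardo (s p : ℝ) (u : ℝ → ℝ) : ℝ≥0∞ :=
  (∫⁻ x in unitI, ∫⁻ y in unitI,
    ENNReal.ofReal (|u x - u y| ^ p / |x - y| ^ (1 + s * p))) ^ (1 / p)

/-- `u ∈ W^{s,p}(I)`, for `0 < s < 1` and `1 ≤ p < ∞`. -/
def MemW (s p : ℝ) (u : ℝ → ℝ) : Prop :=
  MemLp u (ENNReal.ofReal p) (volume.restrict unitI) ∧ gagliardo s p u < ∞

/-- The exponent `p(s) = 1 + s (1 - s)`. -/
def expo (s : ℝ) : ℝ := 1 + s * (1 - s)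

/-- The weight `s (1 - s)`, as a number in `[0,∞]`. -/
def weight (s : ℝ) : ℝ≥0∞ := ENNReal.ofReal (s * (1 - s))

/-- The distributional derivative of `v` on `I` is (the restriction to `I` of) the finite signed
Borel measure `μ`: `∫_I v φ' dx = - ∫ φ dμ` for every `φ ∈ C_c^∞(I)`. -/
def IsDistribDeriv (v : ℝ → ℝ) (μ : SignedMeasure ℝ) : Prop :=
  ∀ φ : 𝓓(unitIOpens, ℝ), ∫ x in unitI, v x * deriv φ x = -∫ᵛ x, φ x ∂•μ

/-- `v ∈ BV(I)`: `v ∈ L¹(I)` and the distributional derivative of `v` on `I` is a finite signed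
measure. -/
def MemBV (v : ℝ → ℝ) : Prop :=
  MemLp v 1 (volume.restrict unitI) ∧ ∃ μ : SignedMeasure ℝ, IsDistribDeriv v μ

end FracSobolev

end

/-! Write `p = expo s`, `q = 1 + s * p`, let `E` be the Gagliardo integral of `u` without its root,
and let `l` be the weighted seminorm, so that `E = (l / (s * (1 - s))) ^ p`. Pass to a subsequence
along which `l` tends to some `L`; it then suffices to bound the limit functional by `L`.

If the limit of `s` is below 1, then `E` stays bounded. It controls the `L¹` oscillation over pairs
at distance less than `r` by `r ^ (1 + s)` (`lintegral_sub_le`), which gives compactness in `L¹`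
through approximation by step functions (`exists_subseq_tendsto_L1`). Fatou's lemma with varying
exponents (`lintegral_kern_le_of_tendsto`) gives the lower bound.

If `s` tends to 1, `E` may blow up like `1 / (1 - s)`. Comparing pairs with their midpoints shows
that halving the distance loses at most a factor `2 ^ δ`, with `δ = p + 1 - q = p * (1 - s)`. Hence
a single dyadic ring carries at most `δ * E` (`lintegral_ring_le`), and `δ * E` tends to `L` because
`(1 - s) ^ (1 - p)` tends to 1 (`tendsto_critical_energy`). Summing over rings restores the
oscillation bound and compactness. By Fatou on each ring, the limit has integrals with exponents 1
and 2 at most `L` on every ring. So at each scale some difference quotient has `L¹` norm at most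
`L`, and a weak limit of these is the derivative (`exists_isDistribDeriv`). -/

namespace FracSobolev

/-! ### Gagliardo integrals on the square. -/

/-- Lebesgue measure on the square `I × I`. -/
noncomputable def pairMeasure : Measure (ℝ × ℝ) :=
  (volume.restrict unitI).prod (volume.restrict unitI)

/-- The Gagliardo integrand `|u(x) - u(y)|^p / |x - y|^q`. -/
noncomputable def kern (p q : ℝ) (u : ℝ → ℝ) (z : ℝ × ℝ) : ℝ≥0∞ :=
  ENNReal.ofReal (|u z.1 - u z.2| ^ p / |z.1 - z.2| ^ q)

/-- The points of the plane at horizontal distance less than `r` from the diagonal. -/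
def near (r : ℝ) : Set (ℝ × ℝ) := {z | |z.1 - z.2| < r}

/-- The points of the plane at horizontal distance between `r / 2` and `r` from the diagonal. -/
def ring (r : ℝ) : Set (ℝ × ℝ) := {z | r / 2 ≤ |z.1 - z.2| ∧ |z.1 - z.2| < r}

instance : IsProbabilityMeasure (volume.restrict unitI) := ⟨by simp [unitI]⟩

instance : IsProbabilityMeasure pairMeasure := by unfold pairMeasure; infer_instance

lemma measurableSet_near (r : ℝ) : MeasurableSet (near r) :=
  measurableSet_lt (by fun_prop) measurable_const

lemma measurableSet_ring (r : ℝ) : MeasurableSet (ring r) :=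
  (by fun_prop : Measurable fun z : ℝ × ℝ => |z.1 - z.2|) measurableSet_Ico

lemma ring_subset_near (r : ℝ) : ring r ⊆ near r := fun _ hz => hz.2

lemma measurable_kern (p q : ℝ) {u : ℝ → ℝ} (hu : Measurable u) : Measurable (kern p q u) := by
  unfold kern; fun_prop

lemma ae_pairMeasure_fst {p : ℝ → Prop}
    (h : ∀ᵐ x ∂(volume.restrict unitI), p x) : ∀ᵐ z ∂pairMeasure, p z.1 :=
  Measure.quasiMeasurePreserving_fst.ae h

lemma ae_pairMeasure_snd {p : ℝ → Prop}
    (h : ∀ᵐ x ∂(volume.restrict unitI), p x) : ∀ᵐ z ∂pairMeasure, p z.2 :=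
  Measure.quasiMeasurePreserving_snd.ae h

lemma gagliardo_congr {s p : ℝ} {u w : ℝ → ℝ} (h : u =ᵐ[volume.restrict unitI] w) :
    gagliardo s p u = gagliardo s p w := by
  unfold gagliardo
  congr 1
  refine lintegral_congr_ae ?_
  filter_upwards [h] with x hx
  refine lintegral_congr_ae ?_
  filter_upwards [h] with y hy
  rw [hx, hy]

lemma gagliardo_eq (s p : ℝ) {u : ℝ → ℝ} (hu : Measurable u) :
    gagliardo s p u = (∫⁻ z, kern p (1 + s * p) u z ∂pairMeasure) ^ (1 / p) := by
  rw [pairMeasure, lintegral_prod _ (measurable_kern _ _ hu).aemeasurable]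
  rfl

/-! ### Midpoint comparison and dyadic rings. -/

lemma lintegral_comp_midpoint (x : ℝ) {f : ℝ → ℝ≥0∞} (hf : Measurable f) :
    ∫⁻ y, f ((x + y) / 2) = 2 * ∫⁻ y, f y := by
  have h1 : ∫⁻ y, f y = ∫⁻ y, f (x / 2 + y) := (lintegral_add_left_eq_self f (x / 2)).symm
  have h2 := Real.map_volume_mul_left (a := 1 / 2) (by norm_num)
  have h3 : ∫⁻ y, f (x / 2 + y) ∂(Measure.map (fun y : ℝ => 1 / 2 * y) volume)
      = ∫⁻ y, f ((x + y) / 2) := by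
    rw [lintegral_map (by fun_prop) (by fun_prop)]
    congr with y
    ring_nf
  rw [← h3, h2, lintegral_smul_measure, h1]
  norm_num

/-- Convexity of `t ^ p` gives `2 ^ (p - 1)`; the midpoint is at half the distance from each end,
which gives `2 ^ (-q)`. -/
lemma kern_le_midpoint {p q : ℝ} (hp : 1 ≤ p) (u : ℝ → ℝ) (x y : ℝ) :
    kern p q u (x, y) ≤ ENNReal.ofReal (2 ^ (p - 1 - q)) *
      (kern p q u (x, (x + y) / 2) + kern p q u (y, (x + y) / 2)) := by
  unfold kern
  rw [← ENNReal.ofReal_add (by positivity) (by positivity), ← ENNReal.ofReal_mul (by positivity)]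
  refine ENNReal.ofReal_le_ofReal ?_
  have hx : |x - y| = 2 * |x - (x + y) / 2| := by
    rw [← abs_two, ← abs_mul, abs_two]; ring_nf
  have hy : |y - (x + y) / 2| = |x - (x + y) / 2| := by
    rw [← abs_neg]; ring_nf
  simp only [hx, hy]
  set D := |x - (x + y) / 2|
  set m := (x + y) / 2
  have key : |u x - u y| ^ p ≤ 2 ^ (p - 1) * (|u x - u m| ^ p + |u y - u m| ^ p) := by
    have h1 : |u x - u y| ≤ |u x - u m| + |u y - u m| := by
      rw [abs_sub_comm (u y)]; exact abs_sub_le _ _ _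
    have h2 := NNReal.rpow_add_le_mul_rpow_add_rpow ⟨|u x - u m|, abs_nonneg _⟩
      ⟨|u y - u m|, abs_nonneg _⟩ hp
    exact (Real.rpow_le_rpow (abs_nonneg _) h1 (by linarith)).trans (by exact_mod_cast h2)
  rw [Real.mul_rpow (by norm_num) (abs_nonneg _), ← add_div, Real.rpow_sub (by norm_num)]
  have : (0:ℝ) < 2 ^ q := by positivity
  rw [div_mul_div_comm]
  gcongr

/-- Moving one point to the midpoint sends the strip of width `r` into that of width `r / 2`, and
stays in the square because `I` is convex. The change of variables costs a factor 2 and the two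
terms another, which turns `2 ^ (p - 1 - q)` into `2 ^ (p + 1 - q)`. -/
lemma lintegral_near_le {p q : ℝ} (hp : 1 ≤ p) {u : ℝ → ℝ} (hu : Measurable u) (r : ℝ) :
    ∫⁻ z in near r, kern p q u z ∂pairMeasure ≤
      ENNReal.ofReal (2 ^ (p + 1 - q)) * ∫⁻ z in near (r / 2), kern p q u z ∂pairMeasure := by
  have hk := measurable_kern p q hu
  set F : ℝ × ℝ → ℝ≥0∞ := (near (r / 2)).indicator (kern p q u) with hF
  have hFm : Measurable F := hk.indicator (measurableSet_near _)
  have hmid : ∫⁻ z, F (z.1, (z.1 + z.2) / 2) ∂pairMeasure ≤ 2 * ∫⁻ z, F z ∂pairMeasure := by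
    have hm2 : Measurable fun z : ℝ × ℝ => F (z.1, (z.1 + z.2) / 2) :=
      hFm.comp (by fun_prop)
    rw [pairMeasure, lintegral_prod _ hm2.aemeasurable, lintegral_prod _ hFm.aemeasurable,
      ← lintegral_const_mul _ (Measurable.lintegral_prod_right' hFm)]
    refine setLIntegral_mono (Measurable.const_mul (Measurable.lintegral_prod_right' hFm) _) ?_
    intro x hx
    have hG : Measurable (unitI.indicator fun m => F (x, m)) :=
      (hFm.comp (by fun_prop)).indicator measurableSet_Ioo
    rw [← lintegral_indicator measurableSet_Ioo (fun m => F (x, m)),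
      ← lintegral_comp_midpoint x hG, ← lintegral_indicator measurableSet_Ioo]
    refine lintegral_mono fun y => ?_
    by_cases hy : y ∈ unitI
    · have : (x + y) / 2 ∈ unitI := by
        simp only [unitI, mem_Ioo] at hx hy ⊢; constructor <;> linarith
      simp [hy, this]
    · simp [hy]
  have hsw : ∫⁻ z, F (z.2, (z.1 + z.2) / 2) ∂pairMeasure =
      ∫⁻ z, F (z.1, (z.1 + z.2) / 2) ∂pairMeasure := by
    rw [pairMeasure, ← lintegral_prod_swap]
    simp [add_comm]
  have hle : ∀ z ∈ near r, kern p q u z ≤ ENNReal.ofReal (2 ^ (p - 1 - q)) *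
      (F (z.1, (z.1 + z.2) / 2) + F (z.2, (z.1 + z.2) / 2)) := by
    rintro ⟨x, y⟩ hz
    have hz' : |x - y| < r := hz
    have h1 : ((x, (x + y) / 2) : ℝ × ℝ) ∈ near (r / 2) := by
      simp only [near, mem_ofPred_eq]
      rw [show x - (x + y) / 2 = (x - y) / 2 by ring, abs_div, abs_two]; linarith
    have h2 : ((y, (x + y) / 2) : ℝ × ℝ) ∈ near (r / 2) := by
      simp only [near, mem_ofPred_eq]
      rw [show y - (x + y) / 2 = -((x - y) / 2) by ring, abs_neg, abs_div, abs_two]; linarith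
    simp only [hF, indicator_of_mem h1, indicator_of_mem h2]
    exact kern_le_midpoint hp u x y
  calc ∫⁻ z in near r, kern p q u z ∂pairMeasure
      ≤ ∫⁻ z in near r, ENNReal.ofReal (2 ^ (p - 1 - q)) *
        (F (z.1, (z.1 + z.2) / 2) + F (z.2, (z.1 + z.2) / 2)) ∂pairMeasure :=
        setLIntegral_mono' (measurableSet_near r) hle
    _ ≤ ∫⁻ z, ENNReal.ofReal (2 ^ (p - 1 - q)) *
        (F (z.1, (z.1 + z.2) / 2) + F (z.2, (z.1 + z.2) / 2)) ∂pairMeasure :=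
        setLIntegral_le_lintegral _ _
    _ = ENNReal.ofReal (2 ^ (p - 1 - q)) * (∫⁻ z, F (z.1, (z.1 + z.2) / 2) ∂pairMeasure +
          ∫⁻ z, F (z.2, (z.1 + z.2) / 2) ∂pairMeasure) := by
        rw [lintegral_const_mul' _ _ ENNReal.ofReal_ne_top, lintegral_add_left]
        exact hFm.comp (by fun_prop)
    _ ≤ ENNReal.ofReal (2 ^ (p - 1 - q)) * (2 * ∫⁻ z, F z ∂pairMeasure +
          2 * ∫⁻ z, F z ∂pairMeasure) := by
        rw [hsw]; gcongr
    _ = _ := by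
        rw [hF, lintegral_indicator (measurableSet_near _), ← two_mul, ← mul_assoc, ← mul_assoc]
        congr 1
        rw [show p + 1 - q = (p - 1 - q) + 1 + 1 by ring, Real.rpow_add_one (by norm_num),
          Real.rpow_add_one (by norm_num), ENNReal.ofReal_mul (by positivity),
          ENNReal.ofReal_mul (by positivity)]
        simp

/-- In a critical regime (`p + 1 - q` small) a dyadic ring carries only a small part of the whole
Gagliardo integral. -/
lemma lintegral_ring_le {p q : ℝ} (hp : 1 ≤ p) (hpq : q ≤ p + 1) {u : ℝ → ℝ}
    (hu : Measurable u) (hE : ∫⁻ z, kern p q u z ∂pairMeasure ≠ ∞) {r : ℝ} (hr : 0 < r) :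
    ∫⁻ z in ring r, kern p q u z ∂pairMeasure ≤
      ENNReal.ofReal (p + 1 - q) * ∫⁻ z, kern p q u z ∂pairMeasure := by
  set δ := p + 1 - q with hδ
  have hδ0 : 0 ≤ δ := by linarith
  have hsplit : ∫⁻ z in near r, kern p q u z ∂pairMeasure =
      ∫⁻ z in near (r / 2), kern p q u z ∂pairMeasure +
        ∫⁻ z in ring r, kern p q u z ∂pairMeasure := by
    rw [← lintegral_union (measurableSet_ring r)]
    · congr 2
      ext z
      simp only [near, ring, mem_union, mem_ofPred_eq]
      constructor
      · intro h
        rcases lt_or_ge |z.1 - z.2| (r / 2) with h' | h'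
        · exact Or.inl h'
        · exact Or.inr ⟨h', h⟩
      · rintro (h | h)
        · linarith
        · exact h.2
    · refine disjoint_left.2 fun z hz hz' => ?_
      exact absurd hz'.1 (not_le.2 hz)
  have hscale := lintegral_near_le (q := q) hp hu r
  have hle : ∀ S : Set (ℝ × ℝ), ∫⁻ z in S, kern p q u z ∂pairMeasure ≤
    ∫⁻ z, kern p q u z ∂pairMeasure := fun S => setLIntegral_le_lintegral _ _
  have hfin : ∀ S : Set (ℝ × ℝ), ∫⁻ z in S, kern p q u z ∂pairMeasure ≠ ∞ :=
    fun S => ((hle S).trans_lt hE.lt_top).ne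
  have hn := hle (near r)
  -- All integrals are finite, so the ring can be treated as the difference of two strips in real
  -- arithmetic.
  obtain ⟨A, hA⟩ : ∃ a : NNReal, (a : ℝ≥0∞) = _ := ⟨_, ENNReal.coe_toNNReal (hfin (near r))⟩
  obtain ⟨B, hB⟩ : ∃ a : NNReal, (a : ℝ≥0∞) = _ := ⟨_, ENNReal.coe_toNNReal (hfin (near (r / 2)))⟩
  obtain ⟨R, hR⟩ : ∃ a : NNReal, (a : ℝ≥0∞) = _ := ⟨_, ENNReal.coe_toNNReal (hfin (ring r))⟩
  obtain ⟨T, hT⟩ : ∃ a : NNReal, (a : ℝ≥0∞) = _ := ⟨_, ENNReal.coe_toNNReal hE⟩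
  rw [← hA, ← hB, ← hR] at hsplit
  rw [← hA, ← hB] at hscale
  rw [← hA, ← hT] at hn
  rw [← hR, ← hT]
  have h1 : (A : ℝ) = B + R := by exact_mod_cast hsplit
  have h2 : (A : ℝ) ≤ 2 ^ δ * B := by
    have := ENNReal.toReal_mono (by finiteness) hscale
    rwa [ENNReal.toReal_mul, ENNReal.toReal_ofReal (by positivity)] at this
  have h3 : (A : ℝ) ≤ T := by exact_mod_cast hn
  -- Equivalent to `1 - 2 ^ (-δ) ≤ δ`. With it, `R = A - B ≤ (1 - 2 ^ (-δ)) * A ≤ δ * T`; for `δ >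
  -- 1` the bound `R ≤ T` is enough.
  have h4 : (1 - δ) * (2 : ℝ) ^ δ ≤ 1 := by
    have e1 : 1 - δ ≤ (2 : ℝ) ^ (-δ) := by
      rw [Real.rpow_def_of_pos (by norm_num)]
      have := Real.add_one_le_exp (Real.log 2 * -δ)
      have hl : Real.log 2 ≤ 1 := by linarith [Real.log_two_lt_d9]
      nlinarith
    calc (1 - δ) * (2 : ℝ) ^ δ ≤ 2 ^ (-δ) * 2 ^ δ := by gcongr
      _ = 1 := by rw [← Real.rpow_add (by norm_num)]; simp
  have h5 : (R : ℝ) ≤ δ * T := by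
    have hB0 : (0 : ℝ) ≤ B := B.2
    have hA0 : (0 : ℝ) ≤ A := A.2
    rcases le_or_gt δ 1 with h | h
    · have : (1 - δ) * A ≤ B := by
        calc (1 - δ) * A ≤ (1 - δ) * (2 ^ δ * B) := by
              apply mul_le_mul_of_nonneg_left h2; linarith
          _ = ((1 - δ) * 2 ^ δ) * B := by ring
          _ ≤ 1 * B := by gcongr
          _ = B := one_mul _
      nlinarith
    · nlinarith
  rw [← ENNReal.ofReal_coe_nnreal, ← ENNReal.ofReal_coe_nnreal (p := T),
    ← ENNReal.ofReal_mul hδ0]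
  exact ENNReal.ofReal_le_ofReal h5

/-! ### `L¹` oscillation near the diagonal. -/

lemma pairMeasure_near_le (r : ℝ) : pairMeasure (near r) ≤ ENNReal.ofReal (2 * r) := by
  rw [pairMeasure, Measure.prod_apply (measurableSet_near r)]
  have h : ∀ x : ℝ, volume.restrict unitI (Prod.mk x ⁻¹' near r) ≤ ENNReal.ofReal (2 * r) := by
    intro x
    calc volume.restrict unitI (Prod.mk x ⁻¹' near r) ≤ volume (Prod.mk x ⁻¹' near r) :=
          Measure.restrict_apply_le _ _
      _ ≤ volume (Metric.ball x r) := by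
          refine measure_mono fun y hy => ?_
          have hy' : |x - y| < r := hy
          rwa [Metric.mem_ball, Real.dist_eq, abs_sub_comm]
      _ = _ := Real.volume_ball x r
  calc _ ≤ ∫⁻ _, ENNReal.ofReal (2 * r) ∂(volume.restrict unitI) := lintegral_mono h
    _ = _ := by rw [lintegral_const, measure_univ, mul_one]

/-- Apply `t ≤ 1 + t ^ p` to `t = |u x - u y| / r ^ s` and use `|x - y| < r`. This replaces Hölder's
inequality and has constants independent of `p`. -/
lemma abs_sub_le_mul_kern {s p r : ℝ} (hs : 0 < s) (hp : 1 ≤ p) (hr : 0 < r) (u : ℝ → ℝ)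
    {z : ℝ × ℝ} (hz : z ∈ near r) :
    ‖u z.1 - u z.2‖ₑ ≤ ENNReal.ofReal (r ^ s) *
      (1 + ENNReal.ofReal r * kern p (1 + s * p) u z) := by
  have hz' : |z.1 - z.2| < r := hz
  rcases eq_or_ne z.1 z.2 with h0 | h0
  · simp [h0]
  have hD : 0 < |z.1 - z.2| := abs_pos.2 (sub_ne_zero.2 h0)
  rw [kern, ← ENNReal.ofReal_mul hr.le, ← ENNReal.ofReal_one, ← ENNReal.ofReal_add (by simp)
    (by positivity), ← ENNReal.ofReal_mul (by positivity), ← ofReal_norm, Real.norm_eq_abs]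
  refine ENNReal.ofReal_le_ofReal ?_
  set d := |u z.1 - u z.2|
  set D := |z.1 - z.2|
  have hd : 0 ≤ d := abs_nonneg _
  have hrs : 0 < r ^ s := by positivity
  have ha : d / r ^ s ≤ 1 + (d / r ^ s) ^ p := by
    rcases le_or_gt (d / r ^ s) 1 with h | h
    · have : 0 ≤ (d / r ^ s) ^ p := by positivity
      linarith
    · have := Real.rpow_le_rpow_of_exponent_le h.le hp
      rw [Real.rpow_one] at this
      linarith
  have hb : (d / r ^ s) ^ p ≤ r * (d ^ p / D ^ (1 + s * p)) := by
    rw [Real.div_rpow hd hrs.le, ← Real.rpow_mul hr.le]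
    have h1 : D ^ (1 + s * p) ≤ r * r ^ (s * p) := by
      calc D ^ (1 + s * p) ≤ r ^ (1 + s * p) := by gcongr
        _ = _ := by rw [Real.rpow_add hr, Real.rpow_one]
    rw [← mul_div_assoc, div_le_div_iff₀ (by positivity) (by positivity)]
    calc d ^ p * D ^ (1 + s * p) ≤ d ^ p * (r * r ^ (s * p)) := by gcongr
      _ = _ := by ring
  calc d = r ^ s * (d / r ^ s) := by field_simp
    _ ≤ r ^ s * (1 + r * (d ^ p / D ^ (1 + s * p))) := by gcongr; linarith

lemma lintegral_sub_le {s p r : ℝ} (hs : 0 < s) (hp : 1 ≤ p) (hr : 0 < r) (u : ℝ → ℝ)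
    {S : Set (ℝ × ℝ)} (hS : MeasurableSet S) (hSr : S ⊆ near r) :
    ∫⁻ z in S, ‖u z.1 - u z.2‖ₑ ∂pairMeasure ≤ ENNReal.ofReal (r ^ (1 + s)) *
      (2 + ∫⁻ z in S, kern p (1 + s * p) u z ∂pairMeasure) := by
  calc ∫⁻ z in S, ‖u z.1 - u z.2‖ₑ ∂pairMeasure
      ≤ ∫⁻ z in S, ENNReal.ofReal (r ^ s) *
        (1 + ENNReal.ofReal r * kern p (1 + s * p) u z) ∂pairMeasure :=
        setLIntegral_mono' hS fun z hz => abs_sub_le_mul_kern hs hp hr u (hSr hz)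
    _ = ENNReal.ofReal (r ^ s) * (pairMeasure S +
        ENNReal.ofReal r * ∫⁻ z in S, kern p (1 + s * p) u z ∂pairMeasure) := by
        rw [lintegral_const_mul' _ _ ENNReal.ofReal_ne_top,
          lintegral_add_left measurable_const, lintegral_const_mul' _ _ ENNReal.ofReal_ne_top]
        simp
    _ ≤ ENNReal.ofReal (r ^ s) * (ENNReal.ofReal r * 2 +
        ENNReal.ofReal r * ∫⁻ z in S, kern p (1 + s * p) u z ∂pairMeasure) := by
        gcongr
        refine ((measure_mono hSr).trans (pairMeasure_near_le r)).trans_eq ?_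
        rw [mul_comm, ENNReal.ofReal_mul hr.le]
        simp
    _ = _ := by
        rw [← mul_add, ← mul_assoc, ← ENNReal.ofReal_mul (by positivity), add_comm 1 s,
          Real.rpow_add hr, Real.rpow_one]

lemma near_subset_iUnion_ring {r : ℝ} {z : ℝ × ℝ} (hz : z ∈ near r) (h0 : z.1 ≠ z.2) :
    ∃ k : ℕ, z ∈ ring (r * (1 / 2) ^ k) := by
  have hz' : |z.1 - z.2| < r := hz
  have hD : 0 < |z.1 - z.2| := abs_pos.2 (sub_ne_zero.2 h0)
  have hr : 0 < r := hD.trans hz'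
  obtain ⟨n, hn1, hn2⟩ := exists_nat_pow_near_of_lt_one (x := |z.1 - z.2| / r) (y := 1 / 2)
    (by positivity) ((div_le_one hr).2 hz'.le) (by norm_num) (by norm_num)
  rw [lt_div_iff₀ hr] at hn1
  rw [div_le_iff₀ hr] at hn2
  -- Rings exclude their outer radius, so equality puts the point in the next larger ring; at `n =
  -- 0` it would contradict `|z.1 - z.2| < r`.
  rcases hn2.lt_or_eq with h | h
  · refine ⟨n, ?_, ?_⟩
    · rw [pow_succ] at hn1; linarith
    · linarith
  · cases n with
    | zero => simp at h; linarith
    | succ m =>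
      refine ⟨m, ?_, ?_⟩
      · rw [pow_succ] at h; linarith
      · rw [pow_succ] at h
        have : 0 < (1 / 2 : ℝ) ^ m * r := by positivity
        linarith

/-- Each halving of the radius gains at least a factor 2, since `1 + σ ≥ 1`; the geometric series
sums to 2, uniformly in `σ`. -/
lemma lintegral_near_le_of_ring {σ r : ℝ} (hσ : 0 < σ) (hr : 0 < r) {u : ℝ → ℝ} {B : ℝ≥0∞}
    (hB : ∀ ρ, 0 < ρ → ρ ≤ r → ∫⁻ z in ring ρ, ‖u z.1 - u z.2‖ₑ ∂pairMeasure ≤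
      ENNReal.ofReal (ρ ^ (1 + σ)) * B) :
    ∫⁻ z in near r, ‖u z.1 - u z.2‖ₑ ∂pairMeasure ≤
      ENNReal.ofReal (r ^ (1 + σ)) * (2 * B) := by
  have hsub : ∫⁻ z in near r, ‖u z.1 - u z.2‖ₑ ∂pairMeasure ≤
      ∫⁻ z in ⋃ k : ℕ, ring (r * (1 / 2) ^ k), ‖u z.1 - u z.2‖ₑ ∂pairMeasure := by
    rw [← lintegral_indicator (measurableSet_near r),
      ← lintegral_indicator (MeasurableSet.iUnion fun k => measurableSet_ring _)]
    refine lintegral_mono fun z => ?_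
    by_cases hz : z ∈ near r
    · by_cases h0 : z.1 = z.2
      · simp [hz, h0]
      · rw [indicator_of_mem hz, indicator_of_mem]
        exact mem_iUnion.2 (near_subset_iUnion_ring hz h0)
    · simp [hz]
  refine (hsub.trans (lintegral_iUnion_le _ _)).trans ?_
  have hk : ∀ k : ℕ, ∫⁻ z in ring (r * (1 / 2) ^ k), ‖u z.1 - u z.2‖ₑ ∂pairMeasure ≤
      ENNReal.ofReal (r ^ (1 + σ)) * B * 2⁻¹ ^ k := by
    intro k
    have h1 : (1 / 2 : ℝ) ^ k ≤ 1 := pow_le_one₀ (by norm_num) (by norm_num)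
    refine (hB _ (by positivity) (by nlinarith)).trans ?_
    rw [mul_right_comm]
    gcongr
    rw [Real.mul_rpow hr.le (by positivity), ENNReal.ofReal_mul (by positivity)]
    gcongr
    calc ENNReal.ofReal (((1 / 2 : ℝ) ^ k) ^ (1 + σ)) ≤ ENNReal.ofReal ((1 / 2 : ℝ) ^ k) := by
          refine ENNReal.ofReal_le_ofReal ?_
          calc ((1 / 2 : ℝ) ^ k) ^ (1 + σ) ≤ ((1 / 2 : ℝ) ^ k) ^ (1 : ℝ) :=
                Real.rpow_le_rpow_of_exponent_ge (by positivity) h1 (by linarith)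
            _ = _ := Real.rpow_one _
      _ = 2⁻¹ ^ k := by
          rw [ENNReal.ofReal_pow (by norm_num), one_div, ENNReal.ofReal_inv_of_pos (by norm_num)]
          simp
  refine (ENNReal.tsum_le_tsum hk).trans_eq ?_
  rw [ENNReal.tsum_mul_left, ENNReal.tsum_geometric, ENNReal.one_sub_inv_two, inv_inv]
  ring

/-! ### Compactness in `L¹(I)` through step functions. -/

/-- A sequence in a complete space which is eventually close to compact sets has a convergent
subsequence. -/
lemma exists_subseq_tendsto_of_near_compact {E : Type*} [MetricSpace E] [CompleteSpace E]
    (f : ℕ → E) (h : ∀ ε > 0, ∃ K : Set E, IsCompact K ∧ ∀ᶠ n in atTop, ∃ y ∈ K, dist (f n) y < ε) :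
    ∃ a, ∃ k : ℕ → ℕ, StrictMono k ∧ Tendsto (f ∘ k) atTop (𝓝 a) := by
  have htb : TotallyBounded (range f) := by
    rw [Metric.totallyBounded_iff]
    intro ε hε
    obtain ⟨K, hK, hev⟩ := h (ε / 2) (by positivity)
    obtain ⟨N, hN⟩ := eventually_atTop.1 hev
    obtain ⟨t, ht, hcov⟩ := Metric.totallyBounded_iff.1 hK.totallyBounded (ε / 2) (by positivity)
    -- The finitely many terms not yet close to `K` are added to the net.
    refine ⟨t ∪ f '' (Finset.range N), ht.union ((Finset.finite_toSet _).image f), ?_⟩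
    rintro _ ⟨n, rfl⟩
    rcases lt_or_ge n N with hn | hn
    · exact mem_biUnion (Or.inr ⟨n, by simpa using hn, rfl⟩) (Metric.mem_ball_self hε)
    · obtain ⟨y, hy, hd⟩ := hN n hn
      obtain ⟨c, hc, hyc⟩ := mem_iUnion₂.1 (hcov hy)
      refine mem_biUnion (Or.inl hc) ?_
      rw [Metric.mem_ball] at hyc ⊢
      linarith [dist_triangle (f n) y c]
  have hcpt : IsCompact (closure (range f)) :=
    htb.closure.isCompact_of_isClosed isClosed_closure
  obtain ⟨a, -, k, hk, hlim⟩ := hcpt.tendsto_subseq fun n => subset_closure (mem_range_self n)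
  exact ⟨a, k, hk, hlim⟩

/-- The `i`-th cell of the partition of `[0,1)` into `N` intervals of equal length. -/
def cell (N i : ℕ) : Set ℝ := Ico ((i : ℝ) / N) ((i + 1 : ℝ) / N)

lemma measurableSet_cell (N i : ℕ) : MeasurableSet (cell N i) := measurableSet_Ico

lemma mem_cell_floor {N : ℕ} (hN : 0 < N) {x : ℝ} (hx : x ∈ unitI) : x ∈ cell N ⌊N * x⌋₊ := by
  have hN' : (0 : ℝ) < N := by exact_mod_cast hN
  have h0 : 0 ≤ N * x := mul_nonneg hN'.le hx.1.le
  refine ⟨?_, ?_⟩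
  · rw [div_le_iff₀ hN', mul_comm x]; exact Nat.floor_le h0
  · rw [lt_div_iff₀ hN', mul_comm]; exact Nat.lt_floor_add_one _

lemma floor_lt_of_mem_unitI {N : ℕ} (hN : 0 < N) {x : ℝ} (hx : x ∈ unitI) : ⌊N * x⌋₊ < N := by
  have hN' : (0 : ℝ) < N := by exact_mod_cast hN
  rw [Nat.floor_lt (mul_nonneg hN'.le hx.1.le)]
  nlinarith [hx.2]

lemma eq_floor_of_mem_cell {N i : ℕ} (hN : 0 < N) {x : ℝ} (hx : x ∈ cell N i) :
    ⌊N * x⌋₊ = i := by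
  have hN' : (0 : ℝ) < N := by exact_mod_cast hN
  obtain ⟨h1, h2⟩ := hx
  rw [div_le_iff₀ hN', mul_comm] at h1
  rw [lt_div_iff₀ hN', mul_comm] at h2
  rw [Nat.floor_eq_iff ((Nat.cast_nonneg i).trans h1)]
  exact ⟨h1, h2⟩

lemma restrict_cell {N i : ℕ} (hi : i < N) :
    (volume.restrict unitI) (cell N i) = ENNReal.ofReal (1 / N) := by
  have hN' : (0 : ℝ) < N := by exact_mod_cast (Nat.zero_le i).trans_lt hi
  have hI : volume.restrict unitI = volume.restrict (Ico (0 : ℝ) 1) :=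
    Measure.restrict_congr_set Ioo_ae_eq_Ico
  have hsub : cell N i ⊆ Ico (0 : ℝ) 1 := by
    refine Ico_subset_Ico (by positivity) ?_
    rw [div_le_one hN']
    exact_mod_cast hi
  rw [hI, Measure.restrict_apply (measurableSet_cell N i), inter_eq_left.2 hsub, cell,
    Real.volume_Ico]
  congr 1
  ring

/-- The left side is the average of `f x - f y` over the cell of `x`, whose length `1 / N` keeps
`(x, y)` in the strip. -/
lemma enorm_sub_cell_average_le {f : ℝ → ℝ} (hi : Integrable f (volume.restrict unitI)) {N : ℕ}
    (hN : 0 < N) {x : ℝ} (hx : x ∈ unitI) :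
    ‖f x - N * ∫ y in cell N ⌊N * x⌋₊, f y ∂(volume.restrict unitI)‖ₑ ≤
      N * ∫⁻ y, (near (1 / N)).indicator (fun z => ‖f z.1 - f z.2‖ₑ) (x, y)
        ∂(volume.restrict unitI) := by
  have hN' : (0 : ℝ) < N := by exact_mod_cast hN
  set i := ⌊N * x⌋₊
  set μ := volume.restrict unitI
  have hmeas : μ.real (cell N i) = 1 / N := by
    rw [measureReal_def, restrict_cell (floor_lt_of_mem_unitI hN hx),
      ENNReal.toReal_ofReal (by positivity)]
  have h1 : f x - N * ∫ y in cell N i, f y ∂μ = N * ∫ y in cell N i, (f x - f y) ∂μ := by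
    rw [integral_sub (integrable_const _) hi.integrableOn, setIntegral_const, hmeas]
    simp only [smul_eq_mul]
    field_simp
  rw [h1, enorm_mul]
  have h2 : ‖(N : ℝ)‖ₑ = N := by simp
  rw [h2]
  gcongr
  refine (enorm_integral_le_lintegral_enorm _).trans ?_
  rw [← lintegral_indicator (measurableSet_cell N i)]
  refine lintegral_mono fun y => ?_
  by_cases hy : y ∈ cell N i
  · have hn : ((x, y) : ℝ × ℝ) ∈ near (1 / N) := by
      have hx' := mem_cell_floor hN hx
      have hlen : ((⌊N * x⌋₊ : ℝ) + 1) / N = (⌊N * x⌋₊ : ℝ) / N + 1 / N := by ring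
      have hy' : y ∈ cell N ⌊N * x⌋₊ := hy
      obtain ⟨a1, a2⟩ := hx'
      obtain ⟨b1, b2⟩ := hy'
      change |x - y| < 1 / N
      rw [abs_lt]
      constructor <;> linarith
    rw [indicator_of_mem hy, indicator_of_mem hn]
  · simp [hy]

/-- The step function with value `c i` on the `i`-th cell, as an element of `L¹(I)`. -/
noncomputable def stepL1 (N : ℕ) (c : Fin N → ℝ) : Lp ℝ 1 (volume.restrict unitI) :=
  ∑ i, c i • indicatorConstLp 1 (measurableSet_cell N i)
    (measure_ne_top (volume.restrict unitI) _) (1 : ℝ)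

/-- Continuity in the coefficients makes step functions with bounded coefficients a compact set. -/
lemma continuous_stepL1 (N : ℕ) : Continuous (stepL1 N) := by
  unfold stepL1; fun_prop

lemma stepL1_ae {N : ℕ} (hN : 0 < N) (c : ℕ → ℝ) :
    ∀ᵐ x ∂(volume.restrict unitI), stepL1 N (fun i => c i) x = c ⌊N * x⌋₊ := by
  have h1 : ∀ᵐ x ∂(volume.restrict unitI), ∀ i : Fin N,
      (c i • indicatorConstLp 1 (measurableSet_cell N i)
        (measure_ne_top (volume.restrict unitI) _) (1 : ℝ) : Lp ℝ 1 (volume.restrict unitI)) x =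
      c i * (cell N i).indicator 1 x := by
    rw [ae_all_iff]
    intro i
    filter_upwards [Lp.coeFn_smul (c i) (indicatorConstLp 1 (measurableSet_cell N i)
      (measure_ne_top (volume.restrict unitI) _) (1 : ℝ)), indicatorConstLp_coeFn (p := 1)
      (hs := measurableSet_cell N i) (hμs := measure_ne_top (volume.restrict unitI) _)
      (c := (1 : ℝ))] with x h2 h3
    rw [h2, Pi.smul_apply, h3, smul_eq_mul]
    rfl
  filter_upwards [h1, ae_restrict_mem measurableSet_Ioo, Lp.coeFn_fun_finsetSum Finset.univ
    fun i : Fin N => (c i • indicatorConstLp 1 (measurableSet_cell N i)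
        (measure_ne_top (volume.restrict unitI) _) (1 : ℝ) : Lp ℝ 1 (volume.restrict unitI))]
    with x h1 hx h2
  rw [stepL1, h2, Finset.sum_eq_single (⟨⌊N * x⌋₊, floor_lt_of_mem_unitI hN hx⟩ : Fin N)]
  · rw [h1, indicator_of_mem (mem_cell_floor hN hx)]
    simp
  · intro i _ hi
    rw [h1, indicator_of_notMem, mul_zero]
    intro hxi
    exact hi (Fin.ext (eq_floor_of_mem_cell hN hxi).symm)
  · simp

lemma lintegral_near_one (f : ℝ × ℝ → ℝ≥0∞) :
    ∫⁻ z in near 1, f z ∂pairMeasure = ∫⁻ z, f z ∂pairMeasure := by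
  rw [Measure.restrict_eq_self_of_ae_mem]
  filter_upwards [ae_pairMeasure_fst (ae_restrict_mem measurableSet_Ioo),
    ae_pairMeasure_snd (ae_restrict_mem measurableSet_Ioo)] with z h1 h2
  change |z.1 - z.2| < 1
  rw [abs_lt]
  constructor <;> linarith [h1.1, h1.2, h2.1, h2.2]

/-- Zero mean gives `f x = ∫ y, (f x - f y)`, and up to a null set the strip of width 1 is the whole
square. -/
lemma lintegral_enorm_le_of_integral_eq_zero {f : ℝ → ℝ} (hf : Measurable f)
    (hi : Integrable f (volume.restrict unitI)) (h0 : ∫ x in unitI, f x = 0) :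
    ∫⁻ x in unitI, ‖f x‖ₑ ≤ ∫⁻ z in near 1, ‖f z.1 - f z.2‖ₑ ∂pairMeasure := by
  rw [lintegral_near_one, pairMeasure, lintegral_prod _ (by fun_prop)]
  refine lintegral_mono fun x => ?_
  have : f x = ∫ y in unitI, (f x - f y) := by
    rw [integral_sub (integrable_const _) hi, h0]
    simp
  conv_lhs => rw [this]
  exact enorm_integral_le_lintegral_enorm _

lemma dist_stepL1_le {f : ℝ → ℝ} (hf : Measurable f)
    (hi : Integrable f (volume.restrict unitI)) {N : ℕ} (hN : 0 < N) {B : ℝ} (hB : 0 ≤ B)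
    (hT : ∫⁻ z in near (1 / N), ‖f z.1 - f z.2‖ₑ ∂pairMeasure ≤ ENNReal.ofReal B) :
    dist hi.toL1 (stepL1 N fun i => N * ∫ y in cell N i, f y ∂(volume.restrict unitI)) ≤
      N * B := by
  have hN' : (0 : ℝ) < N := by exact_mod_cast hN
  have hm : Measurable fun z : ℝ × ℝ =>
      (near (1 / N)).indicator (fun z => ‖f z.1 - f z.2‖ₑ) z :=
    Measurable.indicator (by fun_prop) (measurableSet_near _)
  rw [dist_edist]
  refine ENNReal.toReal_le_of_le_ofReal (by positivity) ?_
  rw [L1.edist_def]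
  calc _ ≤ ∫⁻ x in unitI, N * ∫⁻ y, (near (1 / N)).indicator (fun z => ‖f z.1 - f z.2‖ₑ) (x, y)
        ∂(volume.restrict unitI) := by
        refine lintegral_mono_ae ?_
        filter_upwards [hi.coeFn_toL1, ae_restrict_mem measurableSet_Ioo, stepL1_ae hN
          fun i => N * ∫ y in cell N i, f y ∂(volume.restrict unitI)] with x h1 hx h2
        rw [h1, h2, edist_eq_enorm_sub]
        exact enorm_sub_cell_average_le hi hN hx
    _ = N * ∫⁻ z in near (1 / N), ‖f z.1 - f z.2‖ₑ ∂pairMeasure := by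
        rw [lintegral_const_mul' _ _ (by simp), ← lintegral_indicator (measurableSet_near _),
          pairMeasure, lintegral_prod _ hm.aemeasurable]
    _ ≤ N * ENNReal.ofReal B := by gcongr
    _ = ENNReal.ofReal (N * B) := by rw [ENNReal.ofReal_mul hN'.le]; simp

/-- Compactness in `L¹(I)` of sequences with zero mean and a uniform `L¹` modulus of
oscillation. -/
lemma exists_subseq_tendsto_L1 {f : ℕ → ℝ → ℝ} (hf : ∀ n, Measurable (f n))
    (hi : ∀ n, Integrable (f n) (volume.restrict unitI)) (h0 : ∀ n, ∫ x in unitI, f n x = 0)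
    {C σ : ℝ} (hC : 0 ≤ C) (hσ : 0 < σ)
    (hT : ∀ᶠ n in atTop, ∀ r : ℝ, 0 < r → r ≤ 1 →
      ∫⁻ z in near r, ‖f n z.1 - f n z.2‖ₑ ∂pairMeasure ≤ ENNReal.ofReal (C * r ^ (1 + σ))) :
    ∃ (w : ℝ → ℝ) (k : ℕ → ℕ), StrictMono k ∧ Measurable w ∧
      Integrable w (volume.restrict unitI) ∧
      Tendsto (fun j => eLpNorm (fun x => f (k j) x - w x) 1 (volume.restrict unitI)) atTop (𝓝 0) ∧
      ∀ᵐ x ∂(volume.restrict unitI), Tendsto (fun j => f (k j) x) atTop (𝓝 (w x)) := by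
  obtain ⟨a, k, hk, hlim⟩ := exists_subseq_tendsto_of_near_compact (fun n => (hi n).toL1) (by
    intro ε hε
    -- The step approximation errs by at most `N * (C * N ^ (-(1 + σ)))`, which is `C * N ^ (-σ)`.
    have hlim : Tendsto (fun N : ℕ => C * (N : ℝ) ^ (-σ)) atTop (𝓝 (C * 0)) :=
      ((tendsto_rpow_neg_atTop hσ).comp tendsto_natCast_atTop_atTop).const_mul C
    rw [mul_zero] at hlim
    obtain ⟨N, hNε, hN⟩ := ((hlim.eventually_lt_const hε).and (eventually_gt_atTop 0)).exists
    have hN' : (0 : ℝ) < N := by exact_mod_cast hN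
    refine ⟨stepL1 N '' Metric.closedBall 0 (N * C),
      (isCompact_closedBall _ _).image (continuous_stepL1 N), ?_⟩
    filter_upwards [hT] with n hn
    refine ⟨_, ⟨fun i => N * ∫ y in cell N i, f n y ∂(volume.restrict unitI), ?_, rfl⟩, ?_⟩
    · rw [mem_closedBall_zero_iff, pi_norm_le_iff_of_nonneg (by positivity)]
      intro i
      rw [norm_mul, RCLike.norm_natCast]
      gcongr
      have h1 := (lintegral_enorm_le_of_integral_eq_zero (hf n) (hi n) (h0 n)).trans
        (hn 1 one_pos le_rfl)
      rw [Real.one_rpow, mul_one] at h1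
      have h2 : ‖∫ y in cell N i, f n y ∂(volume.restrict unitI)‖ₑ ≤ ENNReal.ofReal C :=
        ((enorm_integral_le_lintegral_enorm _).trans (setLIntegral_le_lintegral _ _)).trans h1
      rw [← ofReal_norm] at h2
      exact (ENNReal.ofReal_le_ofReal_iff hC).1 h2
    · have hr : (1 / N : ℝ) ≤ 1 := by
        rw [div_le_one hN']; exact_mod_cast hN
      refine (dist_stepL1_le (hf n) (hi n) hN (by positivity)
        (hn (1 / N) (by positivity) hr)).trans_lt ?_
      refine lt_of_eq_of_lt ?_ hNε
      rw [Real.rpow_add (by positivity), Real.rpow_one, Real.rpow_neg hN'.le, one_div,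
        Real.inv_rpow hN'.le]
      field_simp)
  have h1 : Tendsto (fun j => eLpNorm (f (k j) - (a : ℝ → ℝ)) 1 (volume.restrict unitI)) atTop (𝓝 0) := by
    rw [tendsto_iff_edist_tendsto_0] at hlim
    refine hlim.congr fun j => ?_
    rw [Function.comp_apply, Lp.edist_def]
    refine eLpNorm_congr_ae ?_
    filter_upwards [(hi (k j)).coeFn_toL1] with x hx
    rw [Pi.sub_apply, Pi.sub_apply, ← hx]
  obtain ⟨m, hm, hae⟩ := (tendstoInMeasure_of_tendsto_eLpNorm one_ne_zero
    (fun j => (hi (k j)).aestronglyMeasurable) (Lp.aestronglyMeasurable a) h1).exists_seq_tendsto_ae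
  exact ⟨a, k ∘ m, hk.comp hm, (Lp.stronglyMeasurable a).measurable, L1.integrable_coeFn a,
    h1.comp hm.tendsto_atTop, hae⟩

/-! ### Difference quotients and bounded variation. -/

/-- The difference quotient of `w` with step `h`, extended by zero to the points `x` for which
`x` and `x + h` do not both lie in `I`. -/
noncomputable def diffQuot (w : ℝ → ℝ) (h : ℝ) : ℝ → ℝ :=
  (unitI ∩ (fun x => x + h) ⁻¹' unitI).indicator fun x => (w (x + h) - w x) / h

lemma measurable_diffQuot {w : ℝ → ℝ} (hw : Measurable w) (h : ℝ) : Measurable (diffQuot w h) := by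
  refine Measurable.indicator (by fun_prop) (measurableSet_Ioo.inter ?_)
  exact (measurable_add_const h) measurableSet_Ioo

lemma volume_annulus {r : ℝ} (hr : 0 < r) :
    volume {h : ℝ | r / 2 ≤ |h| ∧ |h| < r} = ENNReal.ofReal r := by
  have : {h : ℝ | r / 2 ≤ |h| ∧ |h| < r} = Ico (r / 2) r ∪ Ioc (-r) (-(r / 2)) := by
    ext h
    simp only [mem_ofPred_eq, mem_union, mem_Ico, mem_Ioc]
    rcases abs_cases h with ⟨h1, h2⟩ | ⟨h1, h2⟩ <;> rw [h1] <;> constructor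
    · exact Or.inl
    · rintro (h | h)
      · exact h
      · constructor <;> linarith
    · intro h; right; constructor <;> linarith
    · rintro (h | h) <;> constructor <;> linarith
  rw [this, measure_union _ measurableSet_Ioc, Real.volume_Ico, Real.volume_Ioc,
    ← ENNReal.ofReal_add (by linarith) (by linarith)]
  · congr 1; ring
  · refine disjoint_left.2 fun x hx hx' => ?_
    linarith [hx.1, hx'.2]

/-- If the critical Gagliardo integral over a dyadic ring is at most `Λ`, some difference quotient
at that scale has `L¹` norm at most `Λ`. -/
lemma exists_diffQuot_le {w : ℝ → ℝ} (hw : Measurable w) {r Λ : ℝ} (hr : 0 < r) (hΛ : 0 ≤ Λ)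
    (hE : ∫⁻ z in ring r, kern 1 2 w z ∂pairMeasure ≤ ENNReal.ofReal Λ) :
    ∃ h : ℝ, r / 2 ≤ |h| ∧ |h| < r ∧ ∫⁻ x, ‖diffQuot w h x‖ₑ ≤ ENNReal.ofReal Λ := by
  set A : Set ℝ := {h : ℝ | r / 2 ≤ |h| ∧ |h| < r} with hA
  have hAm : MeasurableSet A := (by fun_prop : Measurable fun h : ℝ => |h|) measurableSet_Ico
  set G : ℝ × ℝ → ℝ≥0∞ := (unitI ×ˢ unitI ∩ ring r).indicator (kern 1 2 w) with hG
  have hGm : Measurable G := (measurable_kern _ _ hw).indicator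
    ((measurableSet_Ioo.prod measurableSet_Ioo).inter (measurableSet_ring r))
  have hGs : Measurable fun z : ℝ × ℝ => G (z.1, z.1 + z.2) := hGm.comp (by fun_prop)
  have hint : ∫⁻ h, ∫⁻ x, G (x, x + h) = ∫⁻ z in ring r, kern 1 2 w z ∂pairMeasure := by
    rw [← lintegral_lintegral_swap (f := fun x h => G (x, x + h)) hGs.aemeasurable]
    simp_rw [fun x => lintegral_add_left_eq_self (μ := volume) (fun y => G (x, y)) x]
    rw [← lintegral_prod _ hGm.aemeasurable, hG, lintegral_indicator
      ((measurableSet_Ioo.prod measurableSet_Ioo).inter (measurableSet_ring r)), pairMeasure,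
      Measure.prod_restrict, Measure.restrict_restrict (measurableSet_ring r), inter_comm]
  have hGq : ∀ h ∈ A, ∀ x, G (x, x + h) = ENNReal.ofReal |h|⁻¹ * ‖diffQuot w h x‖ₑ := by
    intro h hh x
    have hh0 : 0 < |h| := lt_of_lt_of_le (by linarith) hh.1
    have hring : ((x, x + h) : ℝ × ℝ) ∈ ring r := by
      change r / 2 ≤ |x - (x + h)| ∧ |x - (x + h)| < r
      rw [sub_add_cancel_left, abs_neg]
      exact hh
    by_cases hx : x ∈ unitI ∩ (fun x => x + h) ⁻¹' unitI
    · have hmem : ((x, x + h) : ℝ × ℝ) ∈ unitI ×ˢ unitI ∩ ring r := ⟨⟨hx.1, hx.2⟩, hring⟩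
      rw [hG, indicator_of_mem hmem, diffQuot, indicator_of_mem hx, kern,
        ← ofReal_norm, ← ENNReal.ofReal_mul (by positivity)]
      congr 1
      simp only [Real.rpow_one, norm_div, Real.norm_eq_abs, sub_add_cancel_left, abs_neg]
      rw [abs_sub_comm, Real.rpow_two]
      field_simp
    · rw [hG, indicator_of_notMem, diffQuot, indicator_of_notMem hx]
      · simp
      · exact fun h' => hx ⟨h'.1.1, h'.1.2⟩
  have hvol := volume_annulus hr
  -- The annulus of steps has measure `r`, and some `h` does no worse than the average. Its bound `Λ
  -- / r` on `|h|⁻¹ * ‖diffQuot w h‖₁` suffices because `|h| < r`.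
  obtain ⟨h, hh, hle⟩ := exists_le_setLAverage (μ := volume) (s := A)
    (f := fun h => ∫⁻ x, G (x, x + h)) (by rw [hvol]; simpa using hr)
    (by rw [hvol]; exact ENNReal.ofReal_ne_top)
    (Measurable.lintegral_prod_left' hGs).aemeasurable
  refine ⟨h, hh.1, hh.2, ?_⟩
  have hh0 : 0 < |h| := lt_of_lt_of_le (by linarith) hh.1
  rw [setLAverage_eq, hvol] at hle
  simp_rw [hGq h hh] at hle
  rw [lintegral_const_mul' _ _ ENNReal.ofReal_ne_top] at hle
  have h1 : ENNReal.ofReal |h|⁻¹ * ∫⁻ x, ‖diffQuot w h x‖ₑ ≤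
      ENNReal.ofReal Λ / ENNReal.ofReal r := by
    refine hle.trans ?_
    gcongr
    refine (setLIntegral_le_lintegral _ _).trans ?_
    rw [hint]
    exact hE
  calc ∫⁻ x, ‖diffQuot w h x‖ₑ
      = ENNReal.ofReal |h| * (ENNReal.ofReal |h|⁻¹ * ∫⁻ x, ‖diffQuot w h x‖ₑ) := by
        rw [← mul_assoc, ← ENNReal.ofReal_mul hh0.le, mul_inv_cancel₀ hh0.ne']
        simp
    _ ≤ ENNReal.ofReal |h| * (ENNReal.ofReal Λ / ENNReal.ofReal r) := by gcongr
    _ ≤ ENNReal.ofReal Λ := by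
        rw [← ENNReal.ofReal_div_of_pos hr, ← ENNReal.ofReal_mul hh0.le]
        refine ENNReal.ofReal_le_ofReal ?_
        rw [← mul_div_assoc, div_le_iff₀ hr, mul_comm]
        gcongr
        exact hh.2.le

/-- The difference quotients of an integrable function converge to its distributional
derivative. -/
lemma tendsto_integral_diffQuot {w : ℝ → ℝ} (hw : Integrable w (volume.restrict unitI))
    {φ : ℝ → ℝ} (hφ : ContDiff ℝ 1 φ) (hc : HasCompactSupport φ) (hsupp : tsupport φ ⊆ unitI) :
    Tendsto (fun h => ∫ x, φ x * diffQuot w h x) (𝓝[≠] 0)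
      (𝓝 (-∫ x in unitI, w x * deriv φ x)) := by
  set W : ℝ → ℝ := unitI.indicator w with hW
  have hWi : Integrable W := (integrable_indicator_iff measurableSet_Ioo).2 hw
  obtain ⟨L, hL⟩ := hφ.lipschitzWith_of_hasCompactSupport hc one_ne_zero
  obtain ⟨M, hM⟩ := hc.exists_bound_of_continuous hφ.continuous
  have hφW : Integrable fun x => φ x * W x :=
    hWi.bdd_mul hφ.continuous.aestronglyMeasurable (Eventually.of_forall hM)
  have hφ0 : ∀ x, x ∉ unitI → φ x = 0 := fun x hx =>
    image_eq_zero_of_notMem_tsupport fun h => hx (hsupp h)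
  -- After a translation the difference quotient falls on `φ`, whose Lipschitz constant gives the
  -- dominating function.
  have hlim : Tendsto (fun h => ∫ x, W x * ((φ (x - h) - φ x) / h)) (𝓝[≠] 0)
      (𝓝 (∫ x, W x * (-deriv φ x))) := by
    refine tendsto_integral_filter_of_dominated_convergence (fun x => ‖W x‖ * L) ?_ ?_
      (hWi.norm.mul_const _) ?_
    · refine Eventually.of_forall fun h => hWi.aestronglyMeasurable.mul ?_
      have := hφ.continuous
      exact (by fun_prop : Continuous fun x => (φ (x - h) - φ x) / h).aestronglyMeasurable
    · filter_upwards [self_mem_nhdsWithin] with h hh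
      refine Eventually.of_forall fun x => ?_
      rw [norm_mul, norm_div]
      gcongr
      rw [div_le_iff₀ (norm_pos_iff.2 hh), ← dist_eq_norm]
      refine (hL.dist_le_mul _ _).trans_eq ?_
      rw [dist_eq_norm]
      congr 1
      rw [← norm_neg]; congr 1; ring
    · refine Eventually.of_forall fun x => Tendsto.const_mul _ ?_
      have hd : HasDerivAt φ (deriv φ x) x := (hφ.differentiable one_ne_zero x).hasDerivAt
      have h1 : HasDerivAt (fun h => φ (x - h)) (-deriv φ x) 0 := by
        have h2 : HasDerivAt φ (deriv φ x) (x - 0) := by simpa using hd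
        simpa using h2.comp_const_sub x 0
      have := hasDerivAt_iff_tendsto_slope_zero.1 h1
      refine this.congr fun h => ?_
      simp [div_eq_inv_mul]
  have hrhs : ∫ x, W x * (-deriv φ x) = -∫ x in unitI, w x * deriv φ x := by
    rw [← integral_neg, ← integral_indicator measurableSet_Ioo]
    refine integral_congr_ae (Eventually.of_forall fun x => ?_)
    by_cases hx : x ∈ unitI <;> simp [hW, hx]
  rw [← hrhs]
  refine hlim.congr' ?_
  -- For `|h| < δ`, a translate by `h` of the support of `φ` stays in `I`, so the cut-off in
  -- `diffQuot` has no effect.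
  obtain ⟨δ, hδ, hδs⟩ := hc.isCompact.exists_thickening_subset_open isOpen_Ioo hsupp
  have hsmall : ∀ᶠ h in 𝓝[≠] (0 : ℝ), |h| < δ := by
    refine eventually_nhdsWithin_of_eventually_nhds ?_
    have : Tendsto (fun h : ℝ => |h|) (𝓝 0) (𝓝 |0|) := continuous_abs.tendsto 0
    rw [abs_zero] at this
    exact this.eventually_lt_const hδ
  filter_upwards [hsmall] with h hh
  have hshift : Integrable fun x => φ (x - h) * W x := by
    have h1 : Continuous fun x => φ (x - h) := hφ.continuous.comp (by fun_prop)
    exact hWi.bdd_mul h1.aestronglyMeasurable (Eventually.of_forall fun x => hM (x - h))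
  have hshift' : Integrable fun x => φ x * W (x + h) := by
    simpa using hshift.comp_add_right h
  have e1 : ∀ x, φ x * diffQuot w h x = (φ x * W (x + h) - φ x * W x) / h := by
    intro x
    by_cases hx : x ∈ tsupport φ
    · have hxI := hsupp hx
      have hxh : x + h ∈ unitI := by
        refine hδs (Metric.mem_thickening_iff.2 ⟨x, hx, ?_⟩)
        simpa [Real.dist_eq] using hh
      rw [diffQuot, indicator_of_mem (show x ∈ unitI ∩ (fun x => x + h) ⁻¹' unitI from ⟨hxI, hxh⟩),
        hW, indicator_of_mem hxI, indicator_of_mem hxh]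
      ring
    · simp [image_eq_zero_of_notMem_tsupport hx]
  have e2 : ∫ x, φ x * W (x + h) = ∫ x, φ (x - h) * W x := by
    rw [← integral_add_right_eq_self (fun x => φ (x - h) * W x) h]
    simp
  simp_rw [e1]
  rw [integral_div, integral_sub hshift' hφW, e2, ← integral_sub hshift hφW, ← integral_div]
  congr with x
  ring

/-- Weak compactness of a sequence of densities bounded in `L¹` and supported in `I`. -/
lemma exists_weak_limit {g : ℕ → ℝ → ℝ} (hg : ∀ n, Measurable (g n))
    (hsupp : ∀ n x, x ∉ unitI → g n x = 0) {Λ : ℝ} (hΛ : 0 ≤ Λ)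
    (hb : ∀ n, ∫⁻ x, ‖g n x‖ₑ ≤ ENNReal.ofReal Λ) :
    ∃ (U : Ultrafilter ℕ) (μ ν : FiniteMeasure ℝ), (U : Filter ℕ) ≤ atTop ∧
      ((μ.mass + ν.mass : NNReal) : ℝ) ≤ Λ ∧ ∀ φ : BoundedContinuousFunction ℝ ℝ,
        Tendsto (fun n => ∫ x, φ x * g n x) U (𝓝 (∫ x, φ x ∂μ - ∫ x, φ x ∂ν)) := by
  have hpn : ∀ n, (∫⁻ x, ENNReal.ofReal (g n x)) + ∫⁻ x, ENNReal.ofReal (-g n x) =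
      ∫⁻ x, ‖g n x‖ₑ := by
    intro n
    rw [← lintegral_add_left (hg n).ennreal_ofReal]
    congr with x
    rcases le_total 0 (g n x) with h | h
    · rw [Real.enorm_of_nonneg h, ENNReal.ofReal_of_nonpos (by linarith : -g n x ≤ 0), add_zero]
    · rw [← enorm_neg, Real.enorm_of_nonneg (by linarith : 0 ≤ -g n x),
        ENNReal.ofReal_of_nonpos h, zero_add]
  have hgi : ∀ n, Integrable (g n) := fun n =>
    ⟨(hg n).aestronglyMeasurable, (hb n).trans_lt ENNReal.ofReal_lt_top⟩
  have h1 : ∀ n, IsFiniteMeasure (volume.withDensity fun x => ENNReal.ofReal (g n x)) :=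
    fun n => isFiniteMeasure_withDensity_ofReal (hgi n).2
  have h2 : ∀ n, IsFiniteMeasure (volume.withDensity fun x => ENNReal.ofReal (-g n x)) :=
    fun n => isFiniteMeasure_withDensity_ofReal (hgi n).neg.2
  set P : ℕ → FiniteMeasure ℝ := fun n => ⟨_, h1 n⟩ with hP
  set Q : ℕ → FiniteMeasure ℝ := fun n => ⟨_, h2 n⟩ with hQ
  have hmassP : ∀ n, ((P n).mass : ℝ≥0∞) = ∫⁻ x, ENNReal.ofReal (g n x) := by
    intro n
    rw [FiniteMeasure.ennreal_mass]
    simp [hP]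
  have hmassQ : ∀ n, ((Q n).mass : ℝ≥0∞) = ∫⁻ x, ENNReal.ofReal (-g n x) := by
    intro n
    rw [FiniteMeasure.ennreal_mass]
    simp [hQ]
  have hmass : ∀ n, (P n).mass + (Q n).mass ≤ Λ.toNNReal := by
    intro n
    rw [← ENNReal.coe_le_coe, ENNReal.coe_add, hmassP, hmassQ, hpn]
    exact hb n
  -- All positive and negative parts live on the compact `[0,1]`, so no mass escapes.
  have hnull : ∀ f : ℝ → ℝ, (∀ x, x ∉ unitI → f x = 0) →
      (volume.withDensity fun x => ENNReal.ofReal (f x)) (Icc 0 1)ᶜ = 0 := by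
    intro f hf
    rw [withDensity_apply _ measurableSet_Icc.compl]
    refine setLIntegral_eq_zero measurableSet_Icc.compl fun x hx => ?_
    rw [hf x fun h => hx (Ioo_subset_Icc_self h)]
    simp
  have hK := (isCompact_setOfPred_finiteMeasure_le_of_isCompact Λ.toNNReal
    (isCompact_Icc (a := (0 : ℝ)) (b := 1)))
  have hPK : ∀ n, P n ∈ {μ : FiniteMeasure ℝ | μ.mass ≤ Λ.toNNReal ∧ μ (Icc 0 1)ᶜ = 0} := by
    intro n
    refine ⟨(le_add_of_nonneg_right zero_le).trans (hmass n), ?_⟩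
    rw [← ENNReal.coe_eq_zero, FiniteMeasure.ennreal_coeFn_eq_coeFn_toMeasure]
    exact hnull _ (hsupp n)
  have hQK : ∀ n, Q n ∈ {μ : FiniteMeasure ℝ | μ.mass ≤ Λ.toNNReal ∧ μ (Icc 0 1)ᶜ = 0} := by
    intro n
    refine ⟨(le_add_of_nonneg_left zero_le).trans (hmass n), ?_⟩
    rw [← ENNReal.coe_eq_zero, FiniteMeasure.ennreal_coeFn_eq_coeFn_toMeasure]
    exact hnull _ fun x hx => by simp [hsupp n x hx]
  -- Limits along an ultrafilter finer than `atTop` need only compactness of the set of measures,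
  -- and suffice to identify a limit that exists along `atTop`.
  set U : Ultrafilter ℕ := Ultrafilter.of atTop
  have hU : (U : Filter ℕ) ≤ atTop := Ultrafilter.of_le atTop
  obtain ⟨μ, -, hμ⟩ := hK.ultrafilter_le_nhds (U.map P) (by
    rw [le_principal_iff]; exact Eventually.of_forall (f := (U : Filter ℕ)) hPK)
  obtain ⟨ν, -, hν⟩ := hK.ultrafilter_le_nhds (U.map Q) (by
    rw [le_principal_iff]; exact Eventually.of_forall (f := (U : Filter ℕ)) hQK)
  have hμ' : Tendsto P U (𝓝 μ) := hμ
  have hν' : Tendsto Q U (𝓝 ν) := hν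
  refine ⟨U, μ, ν, hU, ?_, fun φ => ?_⟩
  · have h3 : Tendsto (fun n => (P n).mass + (Q n).mass) U (𝓝 (μ.mass + ν.mass)) :=
      ((FiniteMeasure.continuous_mass.tendsto μ).comp hμ').add
        ((FiniteMeasure.continuous_mass.tendsto ν).comp hν')
    have h4 := le_of_tendsto h3 (Eventually.of_forall hmass)
    have h5 : ((μ.mass + ν.mass : NNReal) : ℝ) ≤ (Λ.toNNReal : ℝ) := by exact_mod_cast h4
    rwa [Real.coe_toNNReal _ hΛ] at h5
  · have h3 := (FiniteMeasure.tendsto_iff_forall_integral_tendsto.1 hμ' φ).sub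
      (FiniteMeasure.tendsto_iff_forall_integral_tendsto.1 hν' φ)
    refine h3.congr fun n => ?_
    have i1 : Integrable fun x => max (g n x) 0 * φ x :=
      (hgi n).pos_part.mul_bdd φ.continuous.aestronglyMeasurable
        (Eventually.of_forall φ.norm_coe_le_norm)
    have i2 : Integrable fun x => max (-g n x) 0 * φ x :=
      (hgi n).neg_part.mul_bdd φ.continuous.aestronglyMeasurable
        (Eventually.of_forall φ.norm_coe_le_norm)
    change ∫ x, φ x ∂(volume.withDensity fun x => ENNReal.ofReal (g n x)) -
      ∫ x, φ x ∂(volume.withDensity fun x => ENNReal.ofReal (-g n x)) = _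
    rw [integral_withDensity_eq_integral_toReal_smul (hg n).ennreal_ofReal
      (Eventually.of_forall fun _ => ENNReal.ofReal_lt_top),
      integral_withDensity_eq_integral_toReal_smul (f := fun x => ENNReal.ofReal (-g n x))
      (hg n).neg.ennreal_ofReal
      (Eventually.of_forall fun _ => ENNReal.ofReal_lt_top)]
    simp only [ENNReal.toReal_ofReal', smul_eq_mul]
    rw [← integral_sub i1 i2]
    congr with x
    rw [← sub_mul, max_zero_sub_max_neg_zero_eq_self, mul_comm]

lemma integral_lsmul_toSignedMeasure (μ : Measure ℝ) [IsFiniteMeasure μ] (φ : ℝ → ℝ) :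
    ∫ᵛ x, φ x ∂•μ.toSignedMeasure = ∫ x, φ x ∂μ := by
  rw [← VectorMeasure.integral_toSignedMeasure]
  congr 1
  ext
  simp

/-- A function whose critical Gagliardo integrals over all dyadic rings are at most `Λ` has
bounded variation, with total variation at most `Λ`. -/
lemma exists_isDistribDeriv {w : ℝ → ℝ} (hw : Measurable w)
    (hwi : Integrable w (volume.restrict unitI)) {Λ : ℝ} (hΛ : 0 ≤ Λ)
    (h : ∀ r, 0 < r → ∫⁻ z in ring r, kern 1 2 w z ∂pairMeasure ≤ ENNReal.ofReal Λ) :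
    ∃ μ : SignedMeasure ℝ, IsDistribDeriv w μ ∧ μ.variation unitI ≤ ENNReal.ofReal Λ := by
  choose t ht1 ht2 ht3 using fun n : ℕ =>
    exists_diffQuot_le hw (r := 1 / ((n : ℝ) + 1)) (by positivity) hΛ (h _ (by positivity))
  have ht : Tendsto t atTop (𝓝[≠] 0) := by
    refine tendsto_nhdsWithin_iff.2 ⟨?_, Eventually.of_forall fun n => ?_⟩
    · exact squeeze_zero_norm (fun n => (ht2 n).le) tendsto_one_div_add_atTop_nhds_zero_nat
    · have : 0 < |t n| := lt_of_lt_of_le (by positivity) (ht1 n)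
      exact abs_pos.1 this
  obtain ⟨U, μ, ν, hU, hmass, hlim⟩ := exists_weak_limit
    (fun n => measurable_diffQuot hw (t n))
    (fun n x hx => indicator_of_notMem (fun h' => hx h'.1) _) hΛ ht3
  refine ⟨(μ : Measure ℝ).toSignedMeasure - (ν : Measure ℝ).toSignedMeasure, fun φ => ?_, ?_⟩
  · have hint : ∀ κ : FiniteMeasure ℝ, (κ : Measure ℝ).toSignedMeasure.Integrable φ := by
      intro κ
      rw [VectorMeasure.Integrable, Measure.variation_toSignedMeasure]
      exact φ.continuous.integrable_of_hasCompactSupport φ.hasCompactSupport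
    rw [VectorMeasure.integral_sub_vectorMeasure (hint μ) (hint ν),
      integral_lsmul_toSignedMeasure, integral_lsmul_toSignedMeasure]
    have h1 := hlim (φ : BoundedContinuousFunction ℝ ℝ)
    have h2 := ((tendsto_integral_diffQuot hwi (φ.contDiff.of_le (by simp)) φ.hasCompactSupport
      φ.tsupport_subset).comp ht).mono_left hU
    have h3 : ∫ x, φ x ∂(μ : Measure ℝ) - ∫ x, φ x ∂(ν : Measure ℝ) = _ :=
      tendsto_nhds_unique h1 h2
    rw [h3, neg_neg]
  · calc ((μ : Measure ℝ).toSignedMeasure - (ν : Measure ℝ).toSignedMeasure).variation unitI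
        ≤ ((μ : Measure ℝ).toSignedMeasure.variation +
          (ν : Measure ℝ).toSignedMeasure.variation) unitI :=
          VectorMeasure.variation_sub_le _
      -- The weak limits may charge the endpoints 0 and 1; for an upper bound that mass may be
      -- included.
      _ ≤ ((μ : Measure ℝ) + (ν : Measure ℝ)) univ := by
          rw [Measure.variation_toSignedMeasure, Measure.variation_toSignedMeasure]
          exact measure_mono (subset_univ _)
      _ = ((μ.mass + ν.mass : NNReal) : ℝ≥0∞) := by
          rw [Measure.add_apply, ENNReal.coe_add, FiniteMeasure.ennreal_mass,
            FiniteMeasure.ennreal_mass]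
      _ ≤ ENNReal.ofReal Λ := by
          rw [← ENNReal.ofReal_coe_nnreal]
          exact ENNReal.ofReal_le_ofReal hmass

/-! ### Lower semicontinuity with varying exponents. -/

lemma kern_sub_const (p q : ℝ) (u : ℝ → ℝ) (c : ℝ) : kern p q (fun x => u x - c) = kern p q u := by
  ext z; simp [kern]

/-- Off the diagonal this is continuity of real powers. On it both sides vanish once the exponent is
positive. -/
lemma tendsto_kern {p q : ℕ → ℝ} {pb qb : ℝ} (hp : Tendsto p atTop (𝓝 pb))
    (hq : Tendsto q atTop (𝓝 qb)) (hpb : 0 < pb) {f : ℕ → ℝ → ℝ} {w : ℝ → ℝ} {z : ℝ × ℝ}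
    (h1 : Tendsto (fun n => f n z.1) atTop (𝓝 (w z.1)))
    (h2 : Tendsto (fun n => f n z.2) atTop (𝓝 (w z.2))) :
    Tendsto (fun n => kern (p n) (q n) (f n) z) atTop (𝓝 (kern pb qb w z)) := by
  unfold kern
  refine ENNReal.tendsto_ofReal ?_
  rcases eq_or_ne z.1 z.2 with h0 | h0
  · rw [h0]
    simp only [sub_self, abs_zero, Real.zero_rpow hpb.ne', zero_div]
    refine tendsto_const_nhds.congr' ?_
    filter_upwards [hp.eventually_const_lt hpb] with n hn
    rw [Real.zero_rpow hn.ne', zero_div]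
  · have hD : 0 < |z.1 - z.2| := abs_pos.2 (sub_ne_zero.2 h0)
    exact ((h1.sub h2).abs.rpow hp (Or.inr hpb)).div
      (tendsto_const_nhds.rpow hq (Or.inl hD.ne')) (by positivity)

/-- Lower semicontinuity of Gagliardo integrals with varying exponents. -/
lemma lintegral_kern_le_of_tendsto {p q : ℕ → ℝ} {pb qb : ℝ} (hp : Tendsto p atTop (𝓝 pb))
    (hq : Tendsto q atTop (𝓝 qb)) (hpb : 0 < pb) {f : ℕ → ℝ → ℝ} (hf : ∀ n, Measurable (f n))
    {w : ℝ → ℝ}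
    (hae : ∀ᵐ x ∂(volume.restrict unitI), Tendsto (fun n => f n x) atTop (𝓝 (w x)))
    (S : Set (ℝ × ℝ)) {b : ℕ → ℝ≥0∞} {B : ℝ≥0∞} (hb : Tendsto b atTop (𝓝 B))
    (hle : ∀ n, ∫⁻ z in S, kern (p n) (q n) (f n) z ∂pairMeasure ≤ b n) :
    ∫⁻ z in S, kern pb qb w z ∂pairMeasure ≤ B := by
  calc ∫⁻ z in S, kern pb qb w z ∂pairMeasure
      = ∫⁻ z in S, liminf (fun n => kern (p n) (q n) (f n) z) atTop ∂pairMeasure := by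
        refine lintegral_congr_ae (ae_restrict_of_ae ?_)
        filter_upwards [ae_pairMeasure_fst hae,
          ae_pairMeasure_snd hae] with z h1 h2
        exact (tendsto_kern hp hq hpb h1 h2).liminf_eq.symm
    _ ≤ liminf (fun n => ∫⁻ z in S, kern (p n) (q n) (f n) z ∂pairMeasure) atTop :=
        lintegral_liminf_le fun n => measurable_kern _ _ (hf n)
    _ ≤ liminf b atTop := liminf_le_liminf (Eventually.of_forall hle)
    _ = B := hb.liminf_eq

/-- By Fubini some slice `x` has finite integral. Since `|x - y| ≤ 1` there, the kernel dominates
`|w y - w x| ^ p`, and the constant `w x` is harmless. -/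
lemma memLp_of_lintegral_kern_lt_top {p q : ℝ} (hp : 1 ≤ p) (hq : 0 ≤ q) {w : ℝ → ℝ}
    (hw : Measurable w) (hE : ∫⁻ z, kern p q w z ∂pairMeasure < ∞) :
    MemLp w (ENNReal.ofReal p) (volume.restrict unitI) := by
  have hp0 : 0 < p := by linarith
  have hk := measurable_kern p q hw
  rw [pairMeasure, lintegral_prod _ hk.aemeasurable] at hE
  obtain ⟨x, hxfin, hx⟩ := ((ae_lt_top (Measurable.lintegral_prod_right' hk) hE.ne).and
    (ae_restrict_mem measurableSet_Ioo)).exists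
  have hle : ∫⁻ y in unitI, ‖w y - w x‖ₑ ^ p < ∞ := by
    refine lt_of_le_of_lt (setLIntegral_mono' measurableSet_Ioo fun y hy => ?_) hxfin
    rw [← ofReal_norm, ENNReal.ofReal_rpow_of_nonneg (norm_nonneg _) hp0.le, kern]
    refine ENNReal.ofReal_le_ofReal ?_
    simp only [Real.norm_eq_abs]
    rcases eq_or_ne x y with h0 | h0
    · simp [h0, Real.zero_rpow hp0.ne']
    have hD : 0 < |x - y| := abs_pos.2 (sub_ne_zero.2 h0)
    have hD1 : |x - y| ≤ 1 := by
      rw [abs_le]; constructor <;> linarith [hx.1, hx.2, hy.1, hy.2]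
    rw [abs_sub_comm (w y), le_div_iff₀ (by positivity)]
    exact mul_le_of_le_one_right (by positivity) (Real.rpow_le_one hD.le hD1 hq)
  have h1 : MemLp (fun y => w y - w x) (ENNReal.ofReal p) (volume.restrict unitI) := by
    refine ⟨by fun_prop, ?_⟩
    rw [eLpNorm_lt_top_iff_lintegral_rpow_enorm_lt_top (by simpa using hp0) ENNReal.ofReal_ne_top,
      ENNReal.toReal_ofReal hp0.le]
    exact hle
  have h2 := h1.add (memLp_const (μ := volume.restrict unitI) (p := ENNReal.ofReal p) (w x))
  refine h2.ae_eq (Eventually.of_forall fun y => ?_)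
  simp

/-! ### Uniform bounds along the sequence. -/

/-- Compactness up to additive constants, under a uniform oscillation bound of order
`1 + s n`. -/
lemma exists_subseq_tendsto_sub_mean {s : ℕ → ℝ} {sb : ℝ} (hsb : 0 < sb)
    (hs : Tendsto s atTop (𝓝 sb)) {u : ℕ → ℝ → ℝ} (hu : ∀ n, Measurable (u n))
    (hi : ∀ n, Integrable (u n) (volume.restrict unitI)) {b : ℕ → ℝ} {B : ℝ}
    (hb0 : ∀ n, 0 ≤ b n) (hb : Tendsto b atTop (𝓝 B))
    (hT : ∀ n r, 0 < r → r ≤ 1 → ∫⁻ z in near r, ‖u n z.1 - u n z.2‖ₑ ∂pairMeasure ≤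
      ENNReal.ofReal (r ^ (1 + s n)) * (2 * (2 + ENNReal.ofReal (b n)))) :
    ∃ (w : ℝ → ℝ) (k : ℕ → ℕ), StrictMono k ∧ Measurable w ∧
      Integrable w (volume.restrict unitI) ∧
      Tendsto (fun j => eLpNorm (fun x => (u (k j) x - ∫ y in unitI, u (k j) y) - w x) 1
        (volume.restrict unitI)) atTop (𝓝 0) ∧
      ∀ᵐ x ∂(volume.restrict unitI),
        Tendsto (fun j => u (k j) x - ∫ y in unitI, u (k j) y) atTop (𝓝 (w x)) := by
  have hB : 0 ≤ B := ge_of_tendsto' hb hb0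
  refine exists_subseq_tendsto_L1 (f := fun n x => u n x - ∫ y in unitI, u n y)
    (fun n => (hu n).sub_const _) (fun n => (hi n).sub (integrable_const _)) (fun n => ?_)
    -- Eventually `b n < B + 1` and `s n > sb / 2`; for `r ≤ 1` the smaller exponent gives the
    -- weaker bound.
    (C := 2 * (2 + (B + 1))) (σ := sb / 2) (by positivity) (by positivity) ?_
  · rw [integral_sub (hi n) (integrable_const _)]
    simp
  · filter_upwards [hb.eventually_lt_const (lt_add_one B),
      hs.eventually_const_lt (half_lt_self hsb)] with n h1 h2 r hr hr1
    simp only [sub_sub_sub_cancel_right]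
    refine (hT n r hr hr1).trans ?_
    have h3 : (2 : ℝ≥0∞) * (2 + ENNReal.ofReal (b n)) = ENNReal.ofReal (2 * (2 + b n)) := by
      rw [ENNReal.ofReal_mul (by norm_num), ENNReal.ofReal_add (by norm_num) (hb0 n)]
      simp
    rw [h3, ← ENNReal.ofReal_mul (by positivity), mul_comm]
    refine ENNReal.ofReal_le_ofReal ?_
    have h4 : r ^ (1 + s n) ≤ r ^ (1 + sb / 2) :=
      Real.rpow_le_rpow_of_exponent_ge hr hr1 (by linarith)
    have := hb0 n
    gcongr

lemma tendsto_expo {s : ℕ → ℝ} {sb : ℝ} (hs : Tendsto s atTop (𝓝 sb)) :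
    Tendsto (fun n => expo (s n)) atTop (𝓝 (expo sb)) :=
  (by unfold expo; fun_prop : Continuous expo).continuousAt.tendsto.comp hs

lemma one_le_expo {s : ℝ} (hs : s ∈ Ioo (0 : ℝ) 1) : 1 ≤ expo s := by
  have := mul_pos hs.1 (sub_pos.2 hs.2)
  unfold expo; linarith

/-- The normalisation of the Gagliardo integral in the critical limit `s → 1`. -/
lemma tendsto_critical_energy {s l : ℕ → ℝ} {L : ℝ} (hs : ∀ n, s n ∈ Ioo (0 : ℝ) 1)
    (hs1 : Tendsto s atTop (𝓝 1)) (hl0 : ∀ n, 0 ≤ l n) (hl : Tendsto l atTop (𝓝 L)) :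
    Tendsto (fun n => expo (s n) * (1 - s n) * (l n / (s n * (1 - s n))) ^ expo (s n))
      atTop (𝓝 L) := by
  have hp : Tendsto (fun n => expo (s n)) atTop (𝓝 1) := by
    simpa [expo] using tendsto_expo hs1
  have he : Tendsto (fun n => 1 - s n) atTop (𝓝 0) := by
    simpa using hs1.const_sub 1
  -- This exponential is `(1 - s) ^ (1 - p)` with `1 - p = -s * (1 - s)`; it tends to 1 because `t *
  -- log t` tends to 0.
  have hlog : Tendsto (fun n => Real.exp (-s n * ((1 - s n) * Real.log (1 - s n)))) atTop
      (𝓝 1) := by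
    have h1 := (Real.continuous_mul_log.tendsto 0).comp he
    have h2 := (Real.continuous_exp.tendsto _).comp (hs1.neg.mul h1)
    simpa [Function.comp_def] using h2
  have hmain : Tendsto (fun n => expo (s n) * (l n ^ expo (s n) / s n ^ expo (s n)) *
      Real.exp (-s n * ((1 - s n) * Real.log (1 - s n)))) atTop (𝓝 L) := by
    have h1 := (hp.mul ((hl.rpow hp (Or.inr one_pos)).div (hs1.rpow hp (Or.inr one_pos))
      (by simp))).mul hlog
    simpa using h1
  refine hmain.congr fun n => ?_
  have hs0 := (hs n).1
  have he0 : 0 < 1 - s n := sub_pos.2 (hs n).2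
  have h3 : Real.exp (-s n * ((1 - s n) * Real.log (1 - s n))) =
      (1 - s n) / (1 - s n) ^ expo (s n) := by
    have h4 : -s n * ((1 - s n) * Real.log (1 - s n)) =
        Real.log (1 - s n) * (1 - expo (s n)) := by
      unfold expo; ring
    rw [h4, ← Real.rpow_def_of_pos he0, Real.rpow_sub he0, Real.rpow_one]
  rw [h3, Real.div_rpow (hl0 n) (by positivity), Real.mul_rpow hs0.le he0.le]
  have : 0 < (1 - s n) ^ expo (s n) := by positivity
  field_simp

/-- The extra factor 2 only gives the bound the same shape as in `osc_le_critical_energy`, so that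
one compactness lemma serves both cases. -/
lemma osc_le_energy {s p : ℝ} (hs : 0 < s) (hp : 1 ≤ p) (u : ℝ → ℝ) {r : ℝ} (hr : 0 < r) :
    ∫⁻ z in near r, ‖u z.1 - u z.2‖ₑ ∂pairMeasure ≤
      ENNReal.ofReal (r ^ (1 + s)) *
        (2 * (2 + ∫⁻ z, kern p (1 + s * p) u z ∂pairMeasure)) := by
  refine (lintegral_sub_le hs hp hr u (measurableSet_near r) Subset.rfl).trans ?_
  gcongr
  calc 2 + ∫⁻ z in near r, kern p (1 + s * p) u z ∂pairMeasure
      ≤ 2 + ∫⁻ z, kern p (1 + s * p) u z ∂pairMeasure := by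
        gcongr; exact Measure.restrict_le_self
    _ ≤ _ := le_mul_of_one_le_left zero_le one_le_two

lemma ring_energy_le {s p : ℝ} (hs : s ≤ 1) (hp : 1 ≤ p) {u : ℝ → ℝ}
    (hu : Measurable u) (hE : ∫⁻ z, kern p (1 + s * p) u z ∂pairMeasure ≠ ∞) {r : ℝ}
    (hr : 0 < r) :
    ∫⁻ z in ring r, kern p (1 + s * p) u z ∂pairMeasure ≤
      ENNReal.ofReal (p * (1 - s)) * ∫⁻ z, kern p (1 + s * p) u z ∂pairMeasure := by
  have h := lintegral_ring_le hp (q := 1 + s * p) (by nlinarith) hu hE hr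
  rwa [show p + 1 - (1 + s * p) = p * (1 - s) by ring] at h

/-- Going through the rings replaces the energy by `p * (1 - s)` times the energy, which stays
bounded as `s` tends to 1. -/
lemma osc_le_critical_energy {s p : ℝ} (hs : 0 < s) (hs1 : s ≤ 1) (hp : 1 ≤ p) {u : ℝ → ℝ}
    (hu : Measurable u) (hE : ∫⁻ z, kern p (1 + s * p) u z ∂pairMeasure ≠ ∞) {r : ℝ}
    (hr : 0 < r) :
    ∫⁻ z in near r, ‖u z.1 - u z.2‖ₑ ∂pairMeasure ≤
      ENNReal.ofReal (r ^ (1 + s)) * (2 * (2 + ENNReal.ofReal (p * (1 - s)) *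
        ∫⁻ z, kern p (1 + s * p) u z ∂pairMeasure)) := by
  refine lintegral_near_le_of_ring hs hr fun ρ hρ _ => ?_
  refine (lintegral_sub_le hs hp hρ u (measurableSet_ring ρ) (ring_subset_near ρ)).trans ?_
  gcongr
  exact ring_energy_le hs1 hp hu hE hρ

lemma exists_measurable_representative {s : ℝ} (hs : s ∈ Ioo (0 : ℝ) 1) {v : ℝ → ℝ}
    (hv : MemW s (expo s) v) :
    ∃ u : ℝ → ℝ, Measurable u ∧ v =ᵐ[volume.restrict unitI] u ∧
      Integrable u (volume.restrict unitI) ∧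
      ∫⁻ z, kern (expo s) (1 + s * expo s) u z ∂pairMeasure =
        ENNReal.ofReal (((weight s * gagliardo s (expo s) v).toReal / (s * (1 - s))) ^ expo s) := by
  have hm := hv.1.1.aemeasurable
  have hp := one_le_expo hs
  have hp0 : 0 < expo s := by linarith
  have hw : 0 < s * (1 - s) := mul_pos hs.1 (sub_pos.2 hs.2)
  refine ⟨hm.mk v, hm.measurable_mk, hm.ae_eq_mk, ?_, ?_⟩
  · refine Integrable.congr ?_ hm.ae_eq_mk
    exact hv.1.integrable (by rwa [ENNReal.one_le_ofReal])
  · have h1 := gagliardo_eq s (expo s) hm.measurable_mk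
    rw [← gagliardo_congr hm.ae_eq_mk] at h1
    have h2 : ∫⁻ z, kern (expo s) (1 + s * expo s) (hm.mk v) z ∂pairMeasure =
        gagliardo s (expo s) v ^ expo s := by
      rw [h1, ← ENNReal.rpow_mul, one_div, inv_mul_cancel₀ hp0.ne', ENNReal.rpow_one]
    rw [h2, ENNReal.toReal_mul, weight, ENNReal.toReal_ofReal hw.le, mul_div_cancel_left₀ _ hw.ne',
      ← ENNReal.ofReal_rpow_of_nonneg ENNReal.toReal_nonneg hp0.le,
      ENNReal.ofReal_toReal hv.2.ne]

lemma gagliardo_le_of_lintegral_kern_le {s p g : ℝ} (hp : 0 < p) (hg : 0 ≤ g) {w : ℝ → ℝ}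
    (hw : Measurable w)
    (h : ∫⁻ z, kern p (1 + s * p) w z ∂pairMeasure ≤ ENNReal.ofReal (g ^ p)) :
    gagliardo s p w ≤ ENNReal.ofReal g := by
  rw [gagliardo_eq s p hw]
  calc _ ≤ ENNReal.ofReal (g ^ p) ^ (1 / p) := by gcongr
    _ = ENNReal.ofReal g := by
      rw [← ENNReal.ofReal_rpow_of_nonneg hg hp.le, ← ENNReal.rpow_mul, one_div,
        mul_inv_cancel₀ hp.ne', ENNReal.rpow_one]

/-! ### The two regimes and the theorem. -/

/-- The subcritical case. -/
lemma exists_limit_of_lt_one {s : ℕ → ℝ} {sb : ℝ} (hs : ∀ n, s n ∈ Ioo (0 : ℝ) 1)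
    (hsb : sb ∈ Ioo (0 : ℝ) 1) (hlim : Tendsto s atTop (𝓝 sb)) {u : ℕ → ℝ → ℝ}
    (hu : ∀ n, Measurable (u n)) (hi : ∀ n, Integrable (u n) (volume.restrict unitI))
    {l : ℕ → ℝ} {L m : ℝ} (hl0 : ∀ n, 0 ≤ l n) (hl : Tendsto l atTop (𝓝 L))
    (hm : Tendsto (fun n => ∫ x in unitI, u n x) atTop (𝓝 m))
    (hE : ∀ n, ∫⁻ z, kern (expo (s n)) (1 + s n * expo (s n)) (u n) z ∂pairMeasure =
        ENNReal.ofReal ((l n / (s n * (1 - s n))) ^ expo (s n))) :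
    ∃ (w : ℝ → ℝ) (k : ℕ → ℕ), StrictMono k ∧ MemW sb (expo sb) w ∧
      Tendsto (fun j => eLpNorm (fun x => u (k j) x - w x) 1 (volume.restrict unitI))
        atTop (𝓝 0) ∧
      weight sb * gagliardo sb (expo sb) w ≤ ENNReal.ofReal L := by
  have hp := one_le_expo hsb
  have hp0 : 0 < expo sb := by linarith
  have hwtb : 0 < sb * (1 - sb) := mul_pos hsb.1 (sub_pos.2 hsb.2)
  have hL : 0 ≤ L := ge_of_tendsto' hl hl0
  have hexp := tendsto_expo hlim
  have hElim : Tendsto (fun n => (l n / (s n * (1 - s n))) ^ expo (s n)) atTop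
      (𝓝 ((L / (sb * (1 - sb))) ^ expo sb)) :=
    (hl.div (hlim.mul (hlim.const_sub 1)) hwtb.ne').rpow hexp (Or.inr hp0)
  have hE0 : ∀ n, 0 ≤ (l n / (s n * (1 - s n))) ^ expo (s n) := fun n =>
    Real.rpow_nonneg (div_nonneg (hl0 n) (mul_pos (hs n).1 (sub_pos.2 (hs n).2)).le) _
  obtain ⟨w, k, hk, hw, hwi, hL1, hae⟩ := exists_subseq_tendsto_sub_mean hsb.1 hlim hu hi hE0
    hElim fun n r hr _ => by
      rw [← hE n]
      exact osc_le_energy (hs n).1 (one_le_expo (hs n)) (u n) hr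
  have hkt := hk.tendsto_atTop
  have hwm : Measurable fun x => w x + m := hw.add_const m
  have hmk := hm.comp hkt
  have hae' : ∀ᵐ x ∂(volume.restrict unitI),
      Tendsto (fun j => u (k j) x) atTop (𝓝 (w x + m)) := by
    filter_upwards [hae] with x hx
    refine (hx.add hmk).congr fun j => ?_
    simp
  have hbd : ∫⁻ z, kern (expo sb) (1 + sb * expo sb) (fun x => w x + m) z ∂pairMeasure ≤
      ENNReal.ofReal ((L / (sb * (1 - sb))) ^ expo sb) := by
    rw [← setLIntegral_univ]
    refine lintegral_kern_le_of_tendsto (hexp.comp hkt)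
      (((hlim.mul hexp).const_add 1).comp hkt) hp0 (fun j => hu (k j)) hae' univ
      (ENNReal.tendsto_ofReal (hElim.comp hkt)) fun j => ?_
    rw [setLIntegral_univ]
    exact (hE (k j)).le
  have hg := gagliardo_le_of_lintegral_kern_le hp0 (by positivity) hwm hbd
  refine ⟨fun x => w x + m, k, hk, ⟨?_, hg.trans_lt ENNReal.ofReal_lt_top⟩, ?_, ?_⟩
  · refine memLp_of_lintegral_kern_lt_top hp ?_ hwm (hbd.trans_lt ENNReal.ofReal_lt_top)
    have := mul_pos hsb.1 hp0
    linarith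
  -- Compactness was for `u` minus its mean; the means converge to `m`, which is added back to the
  -- limit.
  · have hsum : Tendsto (fun j => eLpNorm (fun x => (u (k j) x - ∫ y in unitI, u (k j) y) - w x) 1
        (volume.restrict unitI) + ‖(∫ y in unitI, u (k j) y) - m‖ₑ) atTop (𝓝 0) := by
      have h1 : Tendsto (fun j => ‖(∫ y in unitI, u (k j) y) - m‖ₑ) atTop (𝓝 0) := by
        have := (hmk.sub_const m).enorm
        simpa using this
      simpa using hL1.add h1
    refine tendsto_of_tendsto_of_tendsto_of_le_of_le tendsto_const_nhds hsum
      (fun _ => zero_le) fun j => ?_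
    have hc : ‖(∫ y in unitI, u (k j) y) - m‖ₑ = eLpNorm
        (fun _ : ℝ => (∫ y in unitI, u (k j) y) - m) 1 (volume.restrict unitI) := by
      rw [eLpNorm_const _ one_ne_zero (IsProbabilityMeasure.ne_zero _)]
      simp
    rw [hc]
    refine le_trans (le_of_eq ?_) (eLpNorm_add_le ?_ aestronglyMeasurable_const le_rfl)
    · congr 1
      ext x
      simp only [Pi.add_apply]
      ring
    · have := hu (k j)
      fun_prop
  · calc weight sb * gagliardo sb (expo sb) (fun x => w x + m)
        ≤ weight sb * ENNReal.ofReal (L / (sb * (1 - sb))) := by gcongr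
      _ = ENNReal.ofReal L := by
        rw [weight, ← ENNReal.ofReal_mul hwtb.le, mul_div_cancel₀ _ hwtb.ne']

/-- The critical case. -/
lemma exists_limit_of_eq_one {s : ℕ → ℝ} (hs : ∀ n, s n ∈ Ioo (0 : ℝ) 1)
    (hlim : Tendsto s atTop (𝓝 1)) {u : ℕ → ℝ → ℝ}
    (hu : ∀ n, Measurable (u n)) (hi : ∀ n, Integrable (u n) (volume.restrict unitI))
    {l : ℕ → ℝ} {L : ℝ} (hl0 : ∀ n, 0 ≤ l n) (hl : Tendsto l atTop (𝓝 L))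
    (hE : ∀ n, ∫⁻ z, kern (expo (s n)) (1 + s n * expo (s n)) (u n) z ∂pairMeasure =
        ENNReal.ofReal ((l n / (s n * (1 - s n))) ^ expo (s n))) :
    ∃ (w : ℝ → ℝ) (μ : SignedMeasure ℝ) (k : ℕ → ℕ), StrictMono k ∧
      MemBV w ∧ IsDistribDeriv w μ ∧
      Tendsto (fun j => eLpNorm (fun x => (u (k j) x - ∫ y in unitI, u (k j) y) - w x) 1
        (volume.restrict unitI)) atTop (𝓝 0) ∧
      μ.variation unitI ≤ ENNReal.ofReal L := by
  have hL : 0 ≤ L := ge_of_tendsto' hl hl0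
  have hexp : Tendsto (fun n => expo (s n)) atTop (𝓝 1) := by
    simpa [expo] using tendsto_expo hlim
  have hElim := tendsto_critical_energy hs hlim hl0 hl
  have hp0 : ∀ n, 0 ≤ expo (s n) * (1 - s n) := fun n =>
    mul_nonneg (by linarith [one_le_expo (hs n)]) (sub_pos.2 (hs n).2).le
  have hE0 : ∀ n, 0 ≤ expo (s n) * (1 - s n) * (l n / (s n * (1 - s n))) ^ expo (s n) := fun n =>
    mul_nonneg (hp0 n) (Real.rpow_nonneg
      (div_nonneg (hl0 n) (mul_pos (hs n).1 (sub_pos.2 (hs n).2)).le) _)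
  have hfin : ∀ n, ∫⁻ z, kern (expo (s n)) (1 + s n * expo (s n)) (u n) z ∂pairMeasure ≠ ∞ :=
    fun n => by rw [hE n]; exact ENNReal.ofReal_ne_top
  obtain ⟨w, k, hk, hw, hwi, hL1, hae⟩ := exists_subseq_tendsto_sub_mean one_pos hlim hu hi hE0
    hElim fun n r hr _ => by
      rw [ENNReal.ofReal_mul (hp0 n), ← hE n]
      exact osc_le_critical_energy (hs n).1 (hs n).2.le (one_le_expo (hs n)) (hu n) (hfin n) hr
  have hkt := hk.tendsto_atTop
  have hring : ∀ r, 0 < r → ∫⁻ z in ring r, kern 1 2 w z ∂pairMeasure ≤ ENNReal.ofReal L := by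
    intro r hr
    refine lintegral_kern_le_of_tendsto (hexp.comp hkt) (q := fun j => 1 + s (k j) * expo (s (k j)))
      ?_ one_pos (fun j => (hu (k j)).sub_const _) hae (ring r)
      (ENNReal.tendsto_ofReal (hElim.comp hkt)) fun j => ?_
    · have h1 := ((hlim.mul hexp).const_add 1).comp hkt
      rw [mul_one, one_add_one_eq_two] at h1
      exact h1
    · rw [kern_sub_const, Function.comp_apply, Function.comp_apply, ENNReal.ofReal_mul (hp0 _),
        ← hE (k j)]
      exact ring_energy_le (hs _).2.le (one_le_expo (hs _)) (hu _) (hfin _) hr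
  obtain ⟨μ, hμ, hvar⟩ := exists_isDistribDeriv hw hwi hL hring
  exact ⟨w, μ, k, hk, ⟨memLp_one_iff_integrable.2 hwi, μ, hμ⟩, hμ, hL1, hvar⟩

end FracSobolev

open FracSobolev in
theorem mainTheorem5 (s : ℕ → ℝ) (sbar : ℝ) (v : ℕ → ℝ → ℝ)
    (hs : ∀ n, s n ∈ Ioo (0 : ℝ) 1)
    (hsbar : sbar ∈ Ioc (0 : ℝ) 1)
    (hlim : Tendsto s atTop (𝓝 sbar))
    (hv : ∀ n, FracSobolev.MemW (s n) (FracSobolev.expo (s n)) (v n))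
    (hbound : ⨆ n, FracSobolev.weight (s n) *
      (FracSobolev.gagliardo (s n) (FracSobolev.expo (s n)) (v n) +
        ENNReal.ofReal |∫ x in FracSobolev.unitI, v n x|) < ∞) :
    (sbar < 1 →
      ∃ (vbar : ℝ → ℝ) (k : ℕ → ℕ), StrictMono k ∧
        FracSobolev.MemW sbar (FracSobolev.expo sbar) vbar ∧
        Tendsto (fun j => eLpNorm (fun x => v (k j) x - vbar x) 1
          (volume.restrict FracSobolev.unitI)) atTop (𝓝 0) ∧
        FracSobolev.weight sbar *
            FracSobolev.gagliardo sbar (FracSobolev.expo sbar) vbar ≤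
          liminf (fun j => FracSobolev.weight (s (k j)) *
            FracSobolev.gagliardo (s (k j)) (FracSobolev.expo (s (k j))) (v (k j))) atTop) ∧
    (sbar = 1 →
      ∃ (vbar : ℝ → ℝ) (μ : SignedMeasure ℝ) (k : ℕ → ℕ), StrictMono k ∧
        FracSobolev.MemBV vbar ∧ FracSobolev.IsDistribDeriv vbar μ ∧
        Tendsto (fun j => eLpNorm
          (fun x => (v (k j) x - ∫ y in FracSobolev.unitI, v (k j) y) - vbar x) 1
          (volume.restrict FracSobolev.unitI)) atTop (𝓝 0) ∧
        μ.variation FracSobolev.unitI ≤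
          liminf (fun j => FracSobolev.weight (s (k j)) *
            FracSobolev.gagliardo (s (k j)) (FracSobolev.expo (s (k j))) (v (k j))) atTop) := by
  set l : ℕ → ℝ := fun n => (weight (s n) * gagliardo (s n) (expo (s n)) (v n)).toReal with hl
  set C : ℝ := (⨆ n, weight (s n) * (gagliardo (s n) (expo (s n)) (v n) +
    ENNReal.ofReal |∫ x in unitI, v n x|)).toReal with hC
  have hsup : ∀ n, weight (s n) * gagliardo (s n) (expo (s n)) (v n) +
      weight (s n) * ENNReal.ofReal |∫ x in unitI, v n x| ≤ ENNReal.ofReal C := fun n => by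
    rw [hC, ENNReal.ofReal_toReal hbound.ne, ← mul_add]
    exact le_iSup (fun n => weight (s n) * (gagliardo (s n) (expo (s n)) (v n) +
      ENNReal.ofReal |∫ x in unitI, v n x|)) n
  have hwt : ∀ n, 0 < s n * (1 - s n) := fun n => mul_pos (hs n).1 (sub_pos.2 (hs n).2)
  have hlv : ∀ n, weight (s n) * gagliardo (s n) (expo (s n)) (v n) = ENNReal.ofReal (l n) :=
    fun n => (ENNReal.ofReal_toReal
      (((le_add_of_nonneg_right zero_le).trans (hsup n)).trans_lt ENNReal.ofReal_lt_top).ne).symm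
  have hl0 : ∀ n, 0 ≤ l n := fun n => ENNReal.toReal_nonneg
  have hlC : ∀ n, l n ∈ Icc 0 C := fun n => ⟨hl0 n,
    ENNReal.toReal_le_of_le_ofReal ENNReal.toReal_nonneg
      ((le_add_of_nonneg_right zero_le).trans (hsup n))⟩
  choose u hu huv hi hE using fun n => exists_measurable_representative (hs n) (hv n)
  have hmean : ∀ n, ∫ x in unitI, v n x = ∫ x in unitI, u n x := fun n =>
    integral_congr_ae (huv n)
  -- Once `l` converges along `k₀`, the liminf along every further subsequence is exactly `L`.
  obtain ⟨L, -, k₀, hk₀, hlL⟩ := isCompact_Icc.tendsto_subseq hlC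
  have hliminf : ∀ k : ℕ → ℕ, StrictMono k →
      liminf (fun j => weight (s (k₀ (k j))) *
        gagliardo (s (k₀ (k j))) (expo (s (k₀ (k j)))) (v (k₀ (k j)))) atTop =
      ENNReal.ofReal L := by
    intro k hk
    simp only [hlv]
    exact (ENNReal.tendsto_ofReal (hlL.comp hk.tendsto_atTop)).liminf_eq
  have hlim₀ := hlim.comp hk₀.tendsto_atTop
  refine ⟨fun hlt => ?_, fun heq => ?_⟩
  · have hwtb : 0 < sbar * (1 - sbar) := mul_pos hsbar.1 (sub_pos.2 hlt)
    -- Below 1 the weight stays away from zero, so the hypothesis bounds the means themselves. At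
    -- `sbar = 1` this control is lost, hence the subtraction of the mean there.
    have hmb : ∀ n, |∫ x in unitI, u n x| ≤ C / (s n * (1 - s n)) := by
      intro n
      have h1 := (le_add_of_nonneg_left zero_le).trans (hsup n)
      rw [hmean, weight, ← ENNReal.ofReal_mul (hwt n).le,
        ENNReal.ofReal_le_ofReal_iff ENNReal.toReal_nonneg] at h1
      rwa [le_div_iff₀ (hwt n), mul_comm]
    have hCt : Tendsto (fun n => C / (s n * (1 - s n))) atTop (𝓝 (C / (sbar * (1 - sbar)))) :=
      tendsto_const_nhds.div (hlim.mul (hlim.const_sub 1)) hwtb.ne'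
    obtain ⟨R, hR⟩ := hCt.bddAbove_range
    have hmR : ∀ n, (∫ x in unitI, u (k₀ n) x) ∈ Icc (-R) R := fun n =>
      abs_le.1 ((hmb _).trans (hR (mem_range_self _)))
    obtain ⟨m, -, k₁, hk₁, hm⟩ := isCompact_Icc.tendsto_subseq hmR
    obtain ⟨w, k, hk, hwW, hL1, hle⟩ := exists_limit_of_lt_one (fun j => hs (k₀ (k₁ j)))
      ⟨hsbar.1, hlt⟩ (hlim₀.comp hk₁.tendsto_atTop) (fun j => hu (k₀ (k₁ j)))
      (fun j => hi (k₀ (k₁ j))) (fun j => hl0 (k₀ (k₁ j))) (hlL.comp hk₁.tendsto_atTop) hm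
      (fun j => hE (k₀ (k₁ j)))
    refine ⟨w, fun j => k₀ (k₁ (k j)), hk₀.comp (hk₁.comp hk), hwW, ?_, ?_⟩
    · refine hL1.congr fun j => eLpNorm_congr_ae ?_
      filter_upwards [huv (k₀ (k₁ (k j)))] with x hx
      rw [hx]
    · rw [hliminf (fun j => k₁ (k j)) (hk₁.comp hk)]
      exact hle
  · subst heq
    obtain ⟨w, μ, k, hk, hBV, hμ, hL1, hle⟩ := exists_limit_of_eq_one (fun j => hs (k₀ j))
      hlim₀ (fun j => hu (k₀ j)) (fun j => hi (k₀ j)) (fun j => hl0 (k₀ j)) hlL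
      (fun j => hE (k₀ j))
    refine ⟨w, μ, fun j => k₀ (k j), hk₀.comp hk, hBV, hμ, ?_, ?_⟩
    · refine hL1.congr fun j => eLpNorm_congr_ae ?_
      filter_upwards [huv (k₀ (k j))] with x hx
      rw [hx, hmean]
    · rw [hliminf k hk]
      exact hle
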